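/- **Succinct instances.** A succinct instance of Imbalance consists of a finite simple graph $H$ on $k\ge 0$ vertices, a list of $r\ge 0$ pairs $(\ell_1,T_1),\dots,(\ell_r,T_r)$ with integers $\ell_i\ge 1$ and $T_i\subseteq S:=V(H)$, and a target $t\in\mathbb N$. It represents the graph $G$ with vertex set $S\cup C_1\cup\dots\cup C_r$ (disjoint union, $|C_i|=\ell_i$), in which $S$ induces $H$, each $C_i$ is a clique, every vertex of $C_i$ is adjacent to exactly the vertices of $T_i$ in $S$, and there are no other edges. Thus $S$ is a twin cover of $G$, of size $k$, and the $C_i$ are the components of $G\setminus S$. For an ordering $\sigma$ of $V(G)$ and a vertex $v$, let $\mathcal I(v,\sigma)=|p-q|$, where $p$ and $q$ are the numbers of neighbours of $v$ before and after $v$; let $\mathcal I(\sigma)=\sum_v\mathcal I(v,\sigma)$ and $\mathcal I(G)=\min_\sigma\mathcal I(\sigma)$. The instance is a YES-instance if $\mathcal I(G)\le t$. It is encoded by the sequence of natural numbers, written in binary, formed by $k$, $r$, $t$, the adjacency matrix of $H$, $\ell_1,\dots,\ell_r$, and the characteristic vectors of $T_1,\dots,T_r$. An ordering is *clean* if the vertices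 of each $C_i$ are consecutive. A *certificate* consists of an ordering $s_1<\dots<s_k$ of $S$ and a location $d_i\in\{1,\dots,k+1\}$ for every $i\le r$. An ordering $\sigma$ of $V(G)$ *realizes* it if $\sigma$ orders $S$ as $s_1<\dots<s_k$ and exactly $d_i-1$ vertices of $S$ precede each vertex of $C_i$, for every $i$. Put $S_q=\{s_1,\dots,s_q\}$, $\delta_i=|T_i\setminus S_{d_i-1}|-|T_i\cap S_{d_i-1}|$, and $\gamma(\ell)=\lfloor \ell^2/2\rfloor$. The *value* of the certificate is $\sum_{j=1}^k A_j+\sum_{i=1}^r B_i$, where $$A_j=\Big|\,|N_H(s_j)\setminus S_j|-|N_H(s_j)\cap S_j|+\sum_{i:\,s_j\in T_i,\,d_i>j}\ell_i-\sum_{i:\,s_j\in T_i,\,d_i\le j}\ell_i\Big|,$$ $$B_i=\begin{cases}\sum_{m=1}^{\ell_i}\big|\delta_i+(\ell_i-m)-(m-1)\big| & \text{if } \ell_i\le k,\\ \gamma(\ell_i)+\lfloor\delta_i^2/2\rfloor & \text{if } \ell_i>k,\ \ell_i\text{ even},\\ \gamma(\ell_i)+\lceil\delta_i^2/2\rceil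 & \text{if } \ell_i>k,\ \ell_i \text{ odd}.\end{cases}$$ **Model of computation.** Programs run on a random access machine with natural-number registers and indirectly addressed memory. Its elementary operations include addition, truncated subtraction, multiplication, halving with rounding down, memory access, assignment, and branching on zero. The bit cost charges each operation the binary length of the numbers and addresses it handles. An input is a finite sequence of natural numbers; its bit length is its total length in binary with separators. *Polynomial time* means that the bit cost is bounded by a polynomial in the bit length of the input. *Strongly polynomial time* means that, moreover, the number of elementary operations is bounded by a polynomial in the number of input numbers alone. NP is the class of sets of such sequences with polynomial-time verifiable certificates of polynomial bit length. **Proposition.** 1. Imbalance with succinct input, that is, the set of encodings of YES-instances, is in NP. 2. An instance is a YES-instance if and only if it has a certificate of value at most $t$. The bit length of certificates is bounded by a fixed polynomial in the bit length of the instance. 3. Every clean ordering realizes some certificate. Every certificate is realized by some clean ordering, and every clean ordering that realizes it has imbalance equal to its value. 4. There is a strongly polynomial time algorithm that computes the value of a certificate from the instance and the certificate. -/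

import Mathlib

/-! ## Imbalance of finite graphs -/

namespace Imbalance

/-- An ordering of a finite vertex set: `σ v` is the (0-based) position of `v`. -/
abbrev Ordering (V : Type) [Fintype V] : Type := V ≃ Fin (Fintype.card V)

section Graph

variable {V : Type} [Fintype V]

open Classical in
/-- The number of predecessors of `v`: neighbours of `v` placed before `v`. -/
noncomputable def preds (G : SimpleGraph V) (σ : Ordering V) (v : V) : ℕ :=
  (Finset.univ.filter fun u => G.Adj v u ∧ σ u < σ v).card

open Classical in
/-- The number of successors of `v`: neighbours of `v` placed after `v`. -/
noncomputable def succs (G : SimpleGraph V) (σ : Ordering V) (v : V) : ℕ :=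
  (Finset.univ.filter fun u => G.Adj v u ∧ σ v < σ u).card

/-- The imbalance of the vertex `v` with respect to `σ`. -/
noncomputable def vertexImbalance (G : SimpleGraph V) (σ : Ordering V) (v : V) : ℕ :=
  ((preds G σ v : ℤ) - (succs G σ v : ℤ)).natAbs

/-- The imbalance of the ordering `σ`. -/
noncomputable def orderingImbalance (G : SimpleGraph V) (σ : Ordering V) : ℕ :=
  ∑ v, vertexImbalance G σ v

/-- The imbalance of `G`: the minimum over all orderings (a finite nonempty family of naturals). -/
noncomputable def graphImbalance (G : SimpleGraph V) : ℕ :=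
  ⨅ σ : Ordering V, orderingImbalance G σ

end Graph

/-! ## Succinct instances -/

/-- A succinct instance of Imbalance: a graph `H` on the `k` twin-cover vertices, `r` cliques
outside the twin cover, each given by its size and by its type (its set of neighbours in the twin
cover), and a target. -/
structure Instance where
  k : ℕ
  H : SimpleGraph (Fin k)
  r : ℕ
  size : Fin r → ℕ
  size_pos : ∀ i, 0 < size i
  type : Fin r → Finset (Fin k)
  target : ℕ

namespace Instance

variable (I : Instance)

/-- The vertices of the represented graph: the twin cover, and the cliques `C_i`, `|C_i| = size i`.
-/
abbrev Vertex : Type := Fin I.k ⊕ (Σ i : Fin I.r, Fin (I.size i))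

/-- The represented graph: `H` on the twin cover, each `C_i` a clique completely joined to the
vertices in `type i`, and no other edges. -/
def graph : SimpleGraph I.Vertex where
  Adj
    | .inl u, .inl v => I.H.Adj u v
    | .inl u, .inr y => u ∈ I.type y.1
    | .inr x, .inl v => v ∈ I.type x.1
    | .inr x, .inr y => x ≠ y ∧ x.1 = y.1
  symm := ⟨by
    rintro (u | x) (v | y) h
    · exact I.H.adj_symm h
    · exact h
    · exact h
    · exact ⟨h.1.symm, h.2.symm⟩⟩
  loopless := ⟨by
    rintro (u | x) h
    · exact I.H.loopless.irrefl u h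
    · exact h.1 rfl⟩

/-- `I` is a YES-instance: the imbalance of the represented graph is at most the target. -/
def IsYes : Prop := graphImbalance I.graph ≤ I.target

/-- An ordering is clean if the vertices of every clique `C_i` appear consecutively. -/
def IsClean (σ : Ordering I.Vertex) : Prop :=
  ∀ (i : Fin I.r) (a b : Fin (I.size i)) (z : I.Vertex),
    σ (.inr ⟨i, a⟩) < σ z → σ z < σ (.inr ⟨i, b⟩) → ∃ c, z = .inr ⟨i, c⟩

/-- A certificate: the order of the twin-cover vertices (`pos u` is the 0-based rank of `u`) and,
for each clique, its location, that is, the number of twin-cover vertices that precede it. -/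
structure Certificate where
  pos : Equiv.Perm (Fin I.k)
  loc : Fin I.r → Fin (I.k + 1)

open Classical in
/-- `σ` orders the twin cover as `c` does and places every clique at the location given by `c`. -/
def Realizes (σ : Ordering I.Vertex) (c : I.Certificate) : Prop :=
  (∀ u v : Fin I.k, σ (.inl u) < σ (.inl v) ↔ c.pos u < c.pos v) ∧
  ∀ (i : Fin I.r) (a : Fin (I.size i)),
    (Finset.univ.filter fun u : Fin I.k => σ (.inl u) < σ (.inr ⟨i, a⟩)).card = (c.loc i : ℕ)

/-! ### The closed formulas -/

open Classical in
/-- The imbalance of the twin-cover vertex `s`: neighbours in the twin cover to the right minus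
those to the left, plus the total size of the adjacent cliques to the right minus that of those to
the left, in absolute value. -/
noncomputable def coverFormula (c : I.Certificate) (s : Fin I.k) : ℕ :=
  (((Finset.univ.filter fun u => I.H.Adj s u ∧ c.pos s < c.pos u).card : ℤ)
    - ((Finset.univ.filter fun u => I.H.Adj s u ∧ c.pos u < c.pos s).card : ℤ)
    + (∑ i ∈ Finset.univ.filter (fun i => s ∈ I.type i ∧ (c.pos s : ℕ) < (c.loc i : ℕ)),
        (I.size i : ℤ))
    - (∑ i ∈ Finset.univ.filter (fun i => s ∈ I.type i ∧ (c.loc i : ℕ) ≤ (c.pos s : ℕ)),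
        (I.size i : ℤ))).natAbs

/-- The number of twin-cover neighbours of the clique `C_i` to its right minus the number of those
to its left. -/
def delta (c : I.Certificate) (i : Fin I.r) : ℤ :=
  (((I.type i).filter fun u => (c.loc i : ℕ) ≤ (c.pos u : ℕ)).card : ℤ)
    - (((I.type i).filter fun u => (c.pos u : ℕ) < (c.loc i : ℕ)).card : ℤ)

/-- The intrinsic imbalance of a clique on `l` vertices. -/
def intrinsic (l : ℕ) : ℕ := if Even l then l ^ 2 / 2 else (l ^ 2 - 1) / 2

/-- The total imbalance of the vertices of the clique `C_i`: a sum over its vertices if the clique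
is small (`|C_i| ≤ k`), and the intrinsic imbalance plus `⌊δ² / 2⌋` (even size) or `⌈δ² / 2⌉`
(odd size) if it is large. -/
def cliqueFormula (c : I.Certificate) (i : Fin I.r) : ℕ :=
  if I.size i ≤ I.k then
    ∑ j ∈ Finset.Icc 1 (I.size i),
      (I.delta c i + ((I.size i : ℤ) - (j : ℤ)) - ((j : ℤ) - 1)).natAbs
  else if Even (I.size i) then
    intrinsic (I.size i) + ⌊((I.delta c i : ℚ) ^ 2) / 2⌋₊
  else
    intrinsic (I.size i) + ⌈((I.delta c i : ℚ) ^ 2) / 2⌉₊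

/-- The imbalance that the closed formulas assign to the certificate `c`. -/
noncomputable def formula (c : I.Certificate) : ℕ :=
  ∑ s, I.coverFormula c s + ∑ i, I.cliqueFormula c i

/-! ### Encodings as finite sequences of natural numbers -/

open Classical in
/-- The encoding of an instance: `k`, `r`, the target, the adjacency matrix of `H` row by row, the
clique sizes, and for each clique the characteristic vector of its type. -/
noncomputable def code : List ℕ :=
  [I.k, I.r, I.target]
    ++ ((List.finRange I.k).flatMap fun u =>
          (List.finRange I.k).map fun v => if I.H.Adj u v then 1 else 0)
    ++ (List.finRange I.r).map I.size
    ++ ((List.finRange I.r).flatMap fun i =>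
          (List.finRange I.k).map fun u => if u ∈ I.type i then 1 else 0)

variable {I} in
/-- The encoding of a certificate: the positions of the twin-cover vertices, and the locations of
the cliques. -/
def Certificate.code (c : I.Certificate) : List ℕ :=
  (List.finRange I.k).map (fun u => (c.pos u : ℕ))
    ++ (List.finRange I.r).map (fun i => (c.loc i : ℕ))

end Instance

end Imbalance

/-! ## Random access machines with arithmetic cost and bit cost

Structured programs over finitely many named registers and an indirectly addressed memory, all
holding natural numbers. A run has two costs: the number of elementary operations, and the
logarithmic (bit) cost, in which each operation is charged the binary length of the numbers it
handles, addresses included. -/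

namespace RAM

/-- A machine state: the registers and the memory. -/
structure State where
  reg : ℕ → ℕ
  mem : ℕ → ℕ

/-- Expressions: constants, registers, indirect memory access, addition, subtraction (truncated at
`0`), multiplication and halving (rounded down). -/
inductive Term where
  | const (n : ℕ)
  | reg (i : ℕ)
  | mem (a : Term)
  | add (a b : Term)
  | sub (a b : Term)
  | mul (a b : Term)
  | half (a : Term)

namespace Term

/-- The value of an expression. -/
def eval (s : State) : Term → ℕ
  | const n => n
  | reg i => s.reg i
  | mem a => s.mem (a.eval s)
  | add a b => a.eval s + b.eval s
  | sub a b => a.eval s - b.eval s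
  | mul a b => a.eval s * b.eval s
  | half a => a.eval s / 2

/-- The number of elementary operations in evaluating an expression. -/
def ops : Term → ℕ
  | const _ => 1
  | reg _ => 1
  | mem a => a.ops + 1
  | add a b => a.ops + b.ops + 1
  | sub a b => a.ops + b.ops + 1
  | mul a b => a.ops + b.ops + 1
  | half a => a.ops + 1

/-- The bit cost of evaluating an expression: every intermediate value is charged its binary
length plus one. -/
def bits (s : State) : Term → ℕ
  | const n => n.size + 1
  | reg i => (s.reg i).size + 1
  | mem a => a.bits s + (s.mem (a.eval s)).size + 1
  | add a b => a.bits s + b.bits s + (a.eval s + b.eval s).size + 1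
  | sub a b => a.bits s + b.bits s + (a.eval s - b.eval s).size + 1
  | mul a b => a.bits s + b.bits s + (a.eval s * b.eval s).size + 1
  | half a => a.bits s + (a.eval s / 2).size + 1

end Term

/-- Programs. A condition counts as true if its value is nonzero. -/
inductive Prog where
  | skip
  | assign (i : ℕ) (e : Term)
  | store (a e : Term)
  | seq (p q : Prog)
  | cond (e : Term) (p q : Prog)
  | loop (e : Term) (p : Prog)

/-- `Exec p s s' n b`: started in state `s`, the program `p` halts in state `s'` after `n`
elementary operations, with bit cost `b`. -/
inductive Exec : Prog → State → State → ℕ → ℕ → Prop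
  | skip (s : State) : Exec .skip s s 1 1
  | assign (i : ℕ) (e : Term) (s : State) :
      Exec (.assign i e) s { s with reg := Function.update s.reg i (e.eval s) }
        (e.ops + 1) (e.bits s + 1)
  | store (a e : Term) (s : State) :
      Exec (.store a e) s { s with mem := Function.update s.mem (a.eval s) (e.eval s) }
        (a.ops + e.ops + 1) (a.bits s + e.bits s + 1)
  | seq {p q : Prog} {s s' s'' : State} {n b n' b' : ℕ} :
      Exec p s s' n b → Exec q s' s'' n' b' → Exec (.seq p q) s s'' (n + n') (b + b')
  | condTrue {e : Term} {p q : Prog} {s s' : State} {n b : ℕ} :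
      e.eval s ≠ 0 → Exec p s s' n b →
        Exec (.cond e p q) s s' (e.ops + 1 + n) (e.bits s + 1 + b)
  | condFalse {e : Term} {p q : Prog} {s s' : State} {n b : ℕ} :
      e.eval s = 0 → Exec q s s' n b →
        Exec (.cond e p q) s s' (e.ops + 1 + n) (e.bits s + 1 + b)
  | loopDone {e : Term} {p : Prog} {s : State} :
      e.eval s = 0 → Exec (.loop e p) s s (e.ops + 1) (e.bits s + 1)
  | loopStep {e : Term} {p : Prog} {s s' s'' : State} {n b n' b' : ℕ} :
      e.eval s ≠ 0 → Exec p s s' n b → Exec (.loop e p) s' s'' n' b' →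
        Exec (.loop e p) s s'' (e.ops + 1 + n + n') (e.bits s + 1 + b + b')

/-- Programs are deterministic: the final state and both costs are determined by the start. -/
theorem Exec.deterministic {p : Prog} {s s₁ s₂ : State} {n₁ b₁ n₂ b₂ : ℕ}
    (h₁ : Exec p s s₁ n₁ b₁) (h₂ : Exec p s s₂ n₂ b₂) : s₁ = s₂ ∧ n₁ = n₂ ∧ b₁ = b₂ := by
  induction h₁ generalizing s₂ n₂ b₂ with
  | skip s => cases h₂; exact ⟨rfl, rfl, rfl⟩
  | assign i e s => cases h₂; exact ⟨rfl, rfl, rfl⟩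
  | store a e s => cases h₂; exact ⟨rfl, rfl, rfl⟩
  | seq _ _ ih ih' =>
    cases h₂ with
    | seq k k' =>
      obtain ⟨rfl, rfl, rfl⟩ := ih k
      obtain ⟨rfl, rfl, rfl⟩ := ih' k'
      exact ⟨rfl, rfl, rfl⟩
  | condTrue h _ ih =>
    cases h₂ with
    | condTrue _ k => obtain ⟨rfl, rfl, rfl⟩ := ih k; exact ⟨rfl, rfl, rfl⟩
    | condFalse h' _ => exact absurd h' h
  | condFalse h _ ih =>
    cases h₂ with
    | condTrue h' _ => exact absurd h h'
    | condFalse _ k => obtain ⟨rfl, rfl, rfl⟩ := ih k; exact ⟨rfl, rfl, rfl⟩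
  | loopDone h =>
    cases h₂ with
    | loopDone _ => exact ⟨rfl, rfl, rfl⟩
    | loopStep h' _ _ => exact absurd h h'
  | loopStep h _ _ ih ih' =>
    cases h₂ with
    | loopDone h' => exact absurd h' h
    | loopStep _ k k' =>
      obtain ⟨rfl, rfl, rfl⟩ := ih k
      obtain ⟨rfl, rfl, rfl⟩ := ih' k'
      exact ⟨rfl, rfl, rfl⟩

/-- The initial state on input `l`: register `0` holds the number of input numbers, the memory
holds them from address `0` on, and everything else is `0`. -/
def load (l : List ℕ) : State where
  reg i := if i = 0 then l.length else 0
  mem i := l.getD i 0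

/-- The bit length of a sequence of natural numbers, written in binary with separators. -/
def bitLength (l : List ℕ) : ℕ := (l.map fun n => n.size + 1).sum

/-- The encoding of a pair of sequences as one sequence. -/
def pairCode (x y : List ℕ) : List ℕ := x.length :: (x ++ y)

/-- `f` is computable in polynomial time with respect to the encoding `code` (the output is left in
register `0`): the bit cost is polynomially bounded in the bit length of the input. -/
def PolyTime {α : Type} (code : α → List ℕ) (f : α → ℕ) : Prop :=
  ∃ (p : Prog) (B : Polynomial ℕ), ∀ a, ∃ (s : State) (n b : ℕ),
    Exec p (load (code a)) s n b ∧ s.reg 0 = f a ∧ b ≤ B.eval (bitLength (code a))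

/-- `f` is computable in strongly polynomial time: in polynomial time, by a program for which the
number of elementary operations is bounded by a polynomial in the number of input numbers alone,
independently of their magnitude. -/
def StronglyPolyTime {α : Type} (code : α → List ℕ) (f : α → ℕ) : Prop :=
  ∃ (p : Prog) (N B : Polynomial ℕ), ∀ a, ∃ (s : State) (n b : ℕ),
    Exec p (load (code a)) s n b ∧ s.reg 0 = f a ∧
      n ≤ N.eval (code a).length ∧ b ≤ B.eval (bitLength (code a))

/-- The class NP: polynomial-time verifiable with certificates of polynomial bit length. -/
def InNP (L : Set (List ℕ)) : Prop :=
  ∃ (V : List ℕ × List ℕ → ℕ) (P : Polynomial ℕ),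
    PolyTime (fun z : List ℕ × List ℕ => pairCode z.1 z.2) V ∧
    ∀ x, x ∈ L ↔ ∃ y, bitLength y ≤ P.eval (bitLength x) ∧ V (x, y) = 1

end RAM

namespace Imbalance

/-- The decision problem Imbalance with succinct input, as a set of encoded instances. -/
def succinctImbalance : Set (List ℕ) := {x | ∃ I : Instance, I.code = x ∧ I.IsYes}

end Imbalance

/-!
The value of a certificate is the imbalance of any ordering that realizes it: the neighbours of a
clique vertex are its type and the rest of its clique, so its imbalance depends only on the location
of the clique and on its own rank within the clique (`orderingImbalance_eq_placementCost`,
`placementCost_certificate`). In the closed form, the terms `|δ + l - 1 - 2 m|` with `m < l` add up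
to `(l² + δ² - (|δ| - l)²) / 2`, rounded down, with truncated subtraction (`cliqueSum_eq`).

Conversely every ordering, clean or not, has at least the imbalance of some certificate
(`exists_formula_le`). Keep the order of the twin cover and the order within each clique, and gather
each clique at one location. As long as there are members of the type between two successive
vertices `x`, `y` of a clique, the balance (left minus right) of `y` exceeds that of `x` by at least
`4`. So there is a location such that all clique vertices can move there and gain `2` for every
neighbour they pass (`exists_gathering_location`). A twin-cover vertex loses at most `2` whenever a
neighbour passes it (`abs_coverBalance_le`). Both effects add up over all cliques, which can
therefore be gathered simultaneously (`exists_placementCost_le`).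

For the complexity claims, expressions built from arithmetic, reading of input entries, and sums
over all numbers below the input length are compiled to the machine once and for all. Their number
of operations is a polynomial in the input length whose degree is the nesting depth of the sums, and
the binary length of all numbers is bounded by a linear function of that of the input
(`SumExpr.stronglyPolyTime`). Both the value of a certificate (`Code.value`) and the verifier that
in addition checks the well-formedness of both encodings (`Code.verifier`) are such expressions.
-/

namespace RAM

/-! ### Sum expressions and their compilation -/

/-- Arithmetic expressions over an input sequence: besides the elementary operations and reading an
entry of the input there is a bounded sum, `sum v a`, in which the variable `v` runs over all
numbers below the length `len` of the input. The bound is always `len`, so that the depth of the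
expression controls the number of operations, whatever the input numbers are. -/
inductive SumExpr where
  | const (n : ℕ)
  | len
  | var (v : ℕ)
  | read (a : SumExpr)
  | add (a b : SumExpr)
  | sub (a b : SumExpr)
  | mul (a b : SumExpr)
  | half (a : SumExpr)
  | sum (v : ℕ) (a : SumExpr)

namespace SumExpr

/-- The value of an expression for the input `m` of length `L` and the values `ρ` of the
variables. -/
def eval (m : ℕ → ℕ) (L : ℕ) : SumExpr → (ℕ → ℕ) → ℕ
  | const n, _ => n
  | len, _ => L
  | var v, ρ => ρ v
  | read a, ρ => m (a.eval m L ρ)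
  | add a b, ρ => a.eval m L ρ + b.eval m L ρ
  | sub a b, ρ => a.eval m L ρ - b.eval m L ρ
  | mul a b, ρ => a.eval m L ρ * b.eval m L ρ
  | half a, ρ => a.eval m L ρ / 2
  | sum v a, ρ => ∑ x ∈ Finset.range L, a.eval m L (Function.update ρ v x)

/-- A program that leaves the value of the expression in register `2 * d + 1`. Register `0` holds
the length of the input, the register `2 * v + 2` holds the variable `v`, and the odd registers hold
intermediate results, of which only those from `2 * d + 1` on are overwritten. A sum saves the value
of its variable and restores it at the end, so that variables may be reused. -/
def compile : SumExpr → ℕ → Prog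
  | const n, d => .assign (2 * d + 1) (.const n)
  | len, d => .assign (2 * d + 1) (.reg 0)
  | var v, d => .assign (2 * d + 1) (.reg (2 * v + 2))
  | read a, d => .seq (a.compile d) (.assign (2 * d + 1) (.mem (.reg (2 * d + 1))))
  | add a b, d => .seq (a.compile d) (.seq (b.compile (d + 1))
      (.assign (2 * d + 1) (.add (.reg (2 * d + 1)) (.reg (2 * (d + 1) + 1)))))
  | sub a b, d => .seq (a.compile d) (.seq (b.compile (d + 1))
      (.assign (2 * d + 1) (.sub (.reg (2 * d + 1)) (.reg (2 * (d + 1) + 1)))))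
  | mul a b, d => .seq (a.compile d) (.seq (b.compile (d + 1))
      (.assign (2 * d + 1) (.mul (.reg (2 * d + 1)) (.reg (2 * (d + 1) + 1)))))
  | half a, d => .seq (a.compile d) (.assign (2 * d + 1) (.half (.reg (2 * d + 1))))
  | sum v a, d =>
      .seq (.assign (2 * d + 1) (.reg (2 * v + 2)))
      (.seq (.assign (2 * (d + 1) + 1) (.const 0))
      (.seq (.assign (2 * v + 2) (.const 0))
      (.seq (.loop (.sub (.reg 0) (.reg (2 * v + 2)))
        (.seq (a.compile (d + 2))
        (.seq (.assign (2 * (d + 1) + 1)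
            (.add (.reg (2 * (d + 1) + 1)) (.reg (2 * (d + 2) + 1))))
          (.assign (2 * v + 2) (.add (.reg (2 * v + 2)) (.const 1))))))
      (.seq (.assign (2 * v + 2) (.reg (2 * d + 1)))
        (.assign (2 * d + 1) (.reg (2 * (d + 1) + 1)))))))

open Polynomial in
/-- A bound for the number of operations of the compiled program, as a polynomial in the length of
the input. -/
noncomputable def opsBound : SumExpr → Polynomial ℕ
  | const _ => 2
  | len => 2
  | var _ => 2
  | read a => a.opsBound + 3
  | add a b => a.opsBound + b.opsBound + 4
  | sub a b => a.opsBound + b.opsBound + 4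
  | mul a b => a.opsBound + b.opsBound + 4
  | half a => a.opsBound + 3
  | sum _ a => X * (a.opsBound + 12) + 14

open Polynomial in
/-- A bound for the binary length of all numbers that occur in the evaluation, as a polynomial in a
bound for the binary lengths of the input numbers, of the length of the input and of the
variables. -/
noncomputable def width : SumExpr → Polynomial ℕ
  | const n => C n.size
  | len => X
  | var _ => X
  | read a => a.width + X
  | add a b => a.width + b.width + 1
  | sub a b => a.width + b.width
  | mul a b => a.width + b.width
  | half a => a.width
  | sum _ a => a.width + X + 1

end SumExpr

theorem size_add_le (a b : ℕ) : (a + b).size ≤ a.size + b.size + 1 := by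
  rw [Nat.size_le]
  have ha := Nat.lt_size_self a
  have hb := Nat.lt_size_self b
  have h1 : 2 ^ a.size ≤ 2 ^ (a.size + b.size) := Nat.pow_le_pow_right (by norm_num) (by omega)
  have h2 : 2 ^ b.size ≤ 2 ^ (a.size + b.size) := Nat.pow_le_pow_right (by norm_num) (by omega)
  rw [pow_succ]
  omega

theorem size_mul_le (a b : ℕ) : (a * b).size ≤ a.size + b.size := by
  rw [Nat.size_le, pow_add]
  exact Nat.mul_lt_mul'' (Nat.lt_size_self a) (Nat.lt_size_self b)

theorem size_sum_range_le {f : ℕ → ℕ} {n w : ℕ} (h : ∀ x < n, (f x).size ≤ w) :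
    (∑ x ∈ Finset.range n, f x).size ≤ w + n.size := by
  rcases Nat.eq_zero_or_pos n with rfl | hn
  · simp
  rw [Nat.size_le, pow_add, mul_comm]
  calc ∑ x ∈ Finset.range n, f x ≤ ∑ _x ∈ Finset.range n, 2 ^ w :=
        Finset.sum_le_sum fun x hx => (Nat.size_le.1 (h x (Finset.mem_range.1 hx))).le
    _ = n * 2 ^ w := by simp
    _ < 2 ^ n.size * 2 ^ w := Nat.mul_lt_mul_of_pos_right (Nat.lt_size_self n) (by positivity)

theorem SumExpr.size_eval_le (e : SumExpr) {m : ℕ → ℕ} {L M : ℕ} (hm : ∀ a, (m a).size ≤ M)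
    (hL : L.size ≤ M) {ρ : ℕ → ℕ} (hρ : ∀ v, (ρ v).size ≤ M) :
    (e.eval m L ρ).size ≤ e.width.eval M := by
  induction e generalizing ρ with
  | const n => simp [eval, width]
  | len => simpa [eval, width] using hL
  | var v => simpa [eval, width] using hρ v
  | read a ih =>
    have := hm (a.eval m L ρ)
    simp only [eval, width, Polynomial.eval_add, Polynomial.eval_X]
    omega
  | add a b iha ihb =>
    have := size_add_le (a.eval m L ρ) (b.eval m L ρ)
    have := iha hρ
    have := ihb hρ
    simp only [eval, width, Polynomial.eval_add, Polynomial.eval_one]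
    omega
  | sub a b iha ihb =>
    have := Nat.size_le_size (Nat.sub_le (a.eval m L ρ) (b.eval m L ρ))
    have := iha hρ
    simp only [eval, width, Polynomial.eval_add]
    omega
  | mul a b iha ihb =>
    have := size_mul_le (a.eval m L ρ) (b.eval m L ρ)
    have := iha hρ
    have := ihb hρ
    simp only [eval, width, Polynomial.eval_add]
    omega
  | half a ih =>
    exact (Nat.size_le_size (Nat.div_le_self _ 2)).trans (ih hρ)
  | sum v a ih =>
    have := size_sum_range_le (f := fun x => a.eval m L (Function.update ρ v x)) (n := L)
      (w := a.width.eval M) fun x hx => by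
        refine ih fun u => ?_
        by_cases h : u = v
        · subst h
          simpa using (Nat.size_le_size hx.le).trans hL
        · simpa [Function.update_of_ne h] using hρ u
    simp only [eval, width, Polynomial.eval_add, Polynomial.eval_X, Polynomial.eval_one]
    omega

/-- `Run K p s s' n`: the program `p` leads from `s` to `s'` in `n` operations, at an average bit
cost of at most `K + 1`, as is the case when all numbers that occur have binary length at most
`K`. -/
def Run (K : ℕ) (p : Prog) (s s' : State) (n : ℕ) : Prop :=
  ∃ b, Exec p s s' n b ∧ b ≤ n * (K + 1)

theorem Run.seq {K : ℕ} {p q : Prog} {s s' s'' : State} {n n' : ℕ} (h : Run K p s s' n)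
    (h' : Run K q s' s'' n') : Run K (.seq p q) s s'' (n + n') := by
  obtain ⟨b, h, hb⟩ := h
  obtain ⟨b', h', hb'⟩ := h'
  exact ⟨_, .seq h h', by rw [add_mul]; omega⟩

theorem Run.assign {K : ℕ} {e : Term} {s : State} (i : ℕ) (h : e.bits s ≤ e.ops * (K + 1)) :
    Run K (.assign i e) s { s with reg := Function.update s.reg i (e.eval s) } (e.ops + 1) :=
  ⟨_, .assign i e s, by rw [add_mul]; omega⟩

theorem Run.loopDone {K : ℕ} {e : Term} {p : Prog} {s : State} (h : e.bits s ≤ e.ops * (K + 1))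
    (h0 : e.eval s = 0) : Run K (.loop e p) s s (e.ops + 1) :=
  ⟨_, .loopDone h0, by rw [add_mul]; omega⟩

theorem Run.loopStep {K : ℕ} {e : Term} {p : Prog} {s s' s'' : State} {n n' : ℕ}
    (h : e.bits s ≤ e.ops * (K + 1)) (h0 : e.eval s ≠ 0) (hp : Run K p s s' n)
    (hl : Run K (.loop e p) s' s'' n') : Run K (.loop e p) s s'' (e.ops + 1 + n + n') := by
  obtain ⟨b, hp, hb⟩ := hp
  obtain ⟨b', hl, hb'⟩ := hl
  exact ⟨_, .loopStep h0 hp hl, by simp only [add_mul] at *; omega⟩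

/-- `s'` agrees with `s` in everything that a program compiled at level `d` has to preserve: the
memory, the input length, the variables, and the intermediate results below level `d`. -/
structure Frame (d : ℕ) (s s' : State) : Prop where
  mem : s'.mem = s.mem
  len : s'.reg 0 = s.reg 0
  var : ∀ v, s'.reg (2 * v + 2) = s.reg (2 * v + 2)
  tmp : ∀ j < d, s'.reg (2 * j + 1) = s.reg (2 * j + 1)

theorem Frame.trans {d d' : ℕ} {s s' s'' : State} (h : Frame d s s') (h' : Frame d' s' s'')
    (hd : d ≤ d') : Frame d s s'' where
  mem := h'.mem.trans h.mem
  len := h'.len.trans h.len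
  var v := (h'.var v).trans (h.var v)
  tmp j hj := (h'.tmp j (hj.trans_le hd)).trans (h.tmp j hj)

theorem Frame.update (d : ℕ) (s : State) (x : ℕ) :
    Frame d s { s with reg := Function.update s.reg (2 * d + 1) x } where
  mem := rfl
  len := by simp
  var v := by
    have : 2 * v + 2 ≠ 2 * d + 1 := by omega
    simp [this]
  tmp j hj := by
    have : j ≠ d := by omega
    simp [this]

/-- The state is within the word length `M`: memory, input length and variables have binary length
at most `M`. -/
structure Within (M : ℕ) (s : State) : Prop where
  mem : ∀ a, (s.mem a).size ≤ M
  len : (s.reg 0).size ≤ M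
  var : ∀ v, (s.reg (2 * v + 2)).size ≤ M

theorem Within.frame {M d : ℕ} {s s' : State} (h : Within M s) (hf : Frame d s s') :
    Within M s' where
  mem a := by rw [hf.mem]; exact h.mem a
  len := by rw [hf.len]; exact h.len
  var v := by rw [hf.var]; exact h.var v

namespace SumExpr

/-- The value of an expression in a machine state. -/
abbrev value (e : SumExpr) (s : State) : ℕ := e.eval s.mem (s.reg 0) fun v => s.reg (2 * v + 2)

theorem value_frame (e : SumExpr) {d : ℕ} {s s' : State} (h : Frame d s s') :
    e.value s' = e.value s := by
  simp only [value, h.mem, h.len, h.var]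

theorem size_value_le (e : SumExpr) {M : ℕ} {s : State} (h : Within M s) :
    (e.value s).size ≤ e.width.eval M :=
  e.size_eval_le h.mem h.len h.var

/-- What the compiled program achieves when it is started in the state `s`. -/
def Correct (e : SumExpr) (d K : ℕ) (s : State) : Prop :=
  ∃ s' n, Run K (e.compile d) s s' n ∧ Frame d s s' ∧ s'.reg (2 * d + 1) = e.value s ∧
    n ≤ e.opsBound.eval (s.reg 0)

theorem Correct.of_term {e : SumExpr} {d K : ℕ} {s : State} {t : Term}
    (hc : e.compile d = .assign (2 * d + 1) t) (ht : t.eval s = e.value s) (ho : t.ops = 1)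
    (hb : t.bits s ≤ K + 1) (hn : e.opsBound.eval (s.reg 0) = 2) : e.Correct d K s := by
  refine ⟨_, _, hc ▸ Run.assign _ (by rw [ho]; omega), Frame.update d s _, by simpa using ht, ?_⟩
  rw [hn, ho]

theorem Correct.unary {e a : SumExpr} {d K : ℕ} {s : State} {t : Term} (ha : a.Correct d K s)
    (hc : e.compile d = .seq (a.compile d) (.assign (2 * d + 1) t))
    (ht : ∀ s', Frame d s s' → s'.reg (2 * d + 1) = a.value s → t.eval s' = e.value s ∧
      t.bits s' ≤ 2 * (K + 1))
    (ho : t.ops = 2) (hn : e.opsBound = a.opsBound + 3) : e.Correct d K s := by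
  obtain ⟨s', n, hr, hf, hv, hle⟩ := ha
  obtain ⟨h1, h2⟩ := ht s' hf hv
  refine ⟨_, _, hc ▸ hr.seq (Run.assign _ (by rw [ho]; exact h2)),
    hf.trans (Frame.update d s' _) le_rfl, by simpa using h1, ?_⟩
  have : (3 : Polynomial ℕ).eval (s.reg 0) = 3 := by simp
  rw [hn, ho, Polynomial.eval_add, this]
  omega

theorem Correct.binary {e a b : SumExpr} {d K : ℕ} {s : State} {t : Term} (ha : a.Correct d K s)
    (hb : ∀ s', Frame d s s' → b.Correct (d + 1) K s')
    (hc : e.compile d = .seq (a.compile d) (.seq (b.compile (d + 1)) (.assign (2 * d + 1) t)))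
    (ht : ∀ s', s'.reg (2 * d + 1) = a.value s → s'.reg (2 * (d + 1) + 1) = b.value s →
      t.eval s' = e.value s ∧ t.bits s' ≤ 3 * (K + 1))
    (ho : t.ops = 3) (hn : e.opsBound = a.opsBound + b.opsBound + 4) : e.Correct d K s := by
  obtain ⟨s', n, hr, hf, hv, hle⟩ := ha
  obtain ⟨s'', n', hr', hf', hv', hle'⟩ := hb s' hf
  obtain ⟨h1, h2⟩ := ht s'' ((hf'.tmp d (by omega)).trans hv) (hv'.trans (b.value_frame hf))
  refine ⟨_, _, hc ▸ hr.seq (hr'.seq (Run.assign _ (by rw [ho]; exact h2))),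
    (hf.trans hf' (by omega)).trans (Frame.update d s'' _) le_rfl, by simpa using h1, ?_⟩
  have : (4 : Polynomial ℕ).eval (s.reg 0) = 4 := by simp
  rw [hn, ho, Polynomial.eval_add, Polynomial.eval_add, this]
  rw [hf.len] at hle'
  omega

/-- The loop of a compiled sum, from the iteration `x` on. -/
theorem run_sum_loop {a : SumExpr} {M K : ℕ} (v d : ℕ)
    (iha : ∀ s, Within M s → a.Correct (d + 2) K s) (s₀ : State) (hs₀ : Within M s₀)
    (hK : a.width.eval M + M + 1 ≤ K) (j : ℕ) :
    ∀ (x : ℕ) (s : State), x + j = s₀.reg 0 → s.mem = s₀.mem → s.reg 0 = s₀.reg 0 →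
      (∀ u, s.reg (2 * u + 2) = Function.update (fun u => s₀.reg (2 * u + 2)) v x u) →
      s.reg (2 * (d + 1) + 1) = ∑ y ∈ Finset.range x,
        a.eval s₀.mem (s₀.reg 0) (Function.update (fun u => s₀.reg (2 * u + 2)) v y) →
      ∃ s' n, Run K (.loop (.sub (.reg 0) (.reg (2 * v + 2)))
        (.seq (a.compile (d + 2))
        (.seq (.assign (2 * (d + 1) + 1)
            (.add (.reg (2 * (d + 1) + 1)) (.reg (2 * (d + 2) + 1))))
          (.assign (2 * v + 2) (.add (.reg (2 * v + 2)) (.const 1)))))) s s' n ∧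
        s'.mem = s₀.mem ∧ s'.reg 0 = s₀.reg 0 ∧
        (∀ u, u ≠ v → s'.reg (2 * u + 2) = s₀.reg (2 * u + 2)) ∧
        (∀ i < d + 1, s'.reg (2 * i + 1) = s.reg (2 * i + 1)) ∧
        s'.reg (2 * (d + 1) + 1) = (SumExpr.sum v a).value s₀ ∧
        n ≤ j * (a.opsBound.eval (s₀.reg 0) + 12) + 4 := by
  have hsum : ∀ x ≤ s₀.reg 0, (∑ y ∈ Finset.range x, a.eval s₀.mem (s₀.reg 0)
      (Function.update (fun u => s₀.reg (2 * u + 2)) v y)).size ≤ K := by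
    intro x hx
    refine (Nat.size_le_size (Finset.sum_le_sum_of_subset (Finset.range_mono hx))).trans ?_
    have := (SumExpr.sum v a).size_value_le hs₀
    simp only [value, eval, width, Polynomial.eval_add, Polynomial.eval_X,
      Polynomial.eval_one] at this
    omega
  have hL := hs₀.len
  have hup : ∀ x ≤ s₀.reg 0, ∀ u,
      (Function.update (fun u => s₀.reg (2 * u + 2)) v x u).size ≤ M := by
    intro x hx u
    by_cases h : u = v
    · subst h
      simpa using (Nat.size_le_size hx).trans hL
    · simpa [Function.update_of_ne h] using hs₀.var u
  induction j with
  | zero =>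
    intro x s hx hm hl hv ht
    have hxv := hv v
    simp only [Function.update_self] at hxv
    refine ⟨s, _, Run.loopDone ?_ ?_, hm, hl, fun u hu => ?_, fun _ _ => rfl, ?_, le_add_self⟩
    · have hz : s₀.reg 0 - x = 0 := by omega
      have : x.size ≤ K := (Nat.size_le_size (by omega : x ≤ s₀.reg 0)).trans (by omega)
      simp only [Term.bits, Term.ops, Term.eval, hl, hxv, hz, Nat.size_zero]
      omega
    · simp only [Term.eval]
      omega
    · rw [hv, Function.update_of_ne hu]
    · have hx' : x = s₀.reg 0 := by omega
      rw [ht, hx']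
      rfl
  | succ j ih =>
    intro x s hx hm hl hv ht
    have hxv := hv v
    simp only [Function.update_self] at hxv
    have hxs : x.size ≤ M := (Nat.size_le_size (by omega : x ≤ s₀.reg 0)).trans hL
    have hxs' : (x + 1).size ≤ M := (Nat.size_le_size (by omega : x + 1 ≤ s₀.reg 0)).trans hL
    have hW : Within M s := ⟨fun b => by rw [hm]; exact hs₀.mem b, by rw [hl]; exact hL,
      fun u => by rw [hv]; exact hup x (by omega) u⟩
    obtain ⟨s₁, n₁, hr, hf, hval, hn⟩ := iha s hW
    have hval' : s₁.reg (2 * (d + 2) + 1) = a.eval s₀.mem (s₀.reg 0)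
        (Function.update (fun u => s₀.reg (2 * u + 2)) v x) := by
      rw [hval, value, hm, hl]
      simp only [hv]
    have hacc : s₁.reg (2 * (d + 1) + 1) = s.reg (2 * (d + 1) + 1) := hf.tmp (d + 1) (by omega)
    have hs1v : s₁.reg (2 * v + 2) = x := by rw [hf.var, hxv]
    have hnew : s₁.reg (2 * (d + 1) + 1) + s₁.reg (2 * (d + 2) + 1) =
        ∑ y ∈ Finset.range (x + 1), a.eval s₀.mem (s₀.reg 0)
          (Function.update (fun u => s₀.reg (2 * u + 2)) v y) := by
      rw [Finset.sum_range_succ, hacc, ht, hval']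
    have hsz1 : (s₁.reg (2 * (d + 1) + 1)).size ≤ K := by
      rw [hacc, ht]; exact hsum x (by omega)
    have hsz3 : (s₁.reg (2 * (d + 1) + 1) + s₁.reg (2 * (d + 2) + 1)).size ≤ K := by
      rw [hnew]; exact hsum (x + 1) (by omega)
    have hsz2 : (s₁.reg (2 * (d + 2) + 1)).size ≤ K :=
      (Nat.size_le_size (Nat.le_add_left _ _)).trans hsz3
    have hr2 := Run.assign (K := K) (s := s₁) (2 * (d + 1) + 1)
      (e := .add (.reg (2 * (d + 1) + 1)) (.reg (2 * (d + 2) + 1)))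
      (by simp only [Term.bits, Term.ops, Term.eval]; omega)
    obtain ⟨w, hw⟩ : ∃ w, w = s₁.reg (2 * (d + 1) + 1) + s₁.reg (2 * (d + 2) + 1) := ⟨_, rfl⟩
    simp only [Term.eval, Term.ops, ← hw] at hr2
    rw [← hw] at hnew
    set s₂ : State := { s₁ with reg := Function.update s₁.reg (2 * (d + 1) + 1) w } with hs₂
    have hf2 : Frame (d + 1) s₁ s₂ := Frame.update (d + 1) s₁ _
    have hs2v : s₂.reg (2 * v + 2) = x := by rw [hf2.var, hs1v]
    have hone : Nat.size 1 = 1 := Nat.size_one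
    have hr3 := Run.assign (K := K) (s := s₂) (2 * v + 2)
      (e := .add (.reg (2 * v + 2)) (.const 1))
      (by simp only [Term.bits, Term.ops, Term.eval, hs2v, hone]; omega)
    simp only [Term.eval, Term.ops, hs2v] at hr3
    set s₃ : State := { s₂ with reg := Function.update s₂.reg (2 * v + 2) (x + 1) } with hs₃
    have hodd : ∀ i, s₃.reg (2 * i + 1) = s₂.reg (2 * i + 1) := fun i => by
      rw [hs₃]
      exact Function.update_of_ne (by omega) _ _
    obtain ⟨s', n, hr', hm', hl', hv', ht', hval'', hn'⟩ := ih (x + 1) s₃ (by omega)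
      (by rw [hs₃]; exact hf2.mem.trans (hf.mem.trans hm))
      (by
        have : s₃.reg 0 = s₂.reg 0 := by simp [hs₃]
        rw [this, hf2.len, hf.len, hl])
      (fun u => by
        by_cases h : u = v
        · subst h
          simp [hs₃]
        · have : s₃.reg (2 * u + 2) = s₂.reg (2 * u + 2) := by
            rw [hs₃]; exact Function.update_of_ne (by omega) _ _
          rw [this, hf2.var, hf.var, hv, Function.update_of_ne h, Function.update_of_ne h])
      (by rw [hodd, hs₂, ← hnew]; simp)
    refine ⟨s', _, Run.loopStep ?_ ?_ (hr.seq (hr2.seq hr3)) hr', hm', hl', hv',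
      fun i hi => ?_, hval'', ?_⟩
    · have : (s₀.reg 0 - x).size ≤ M := (Nat.size_le_size (Nat.sub_le _ _)).trans hL
      simp only [Term.bits, Term.ops, Term.eval, hl, hxv]
      omega
    · simp only [Term.eval]
      omega
    · rw [ht' i hi, hodd, hf2.tmp i hi, hf.tmp i (by omega)]
    · rw [hl] at hn
      simp only [Term.ops]
      rw [add_mul]
      omega

/-- Compiled programs compute the value of the expression, within the stated bounds. -/
theorem correct (e : SumExpr) {M K : ℕ} (d : ℕ) {s : State} (hs : Within M s)
    (hK : e.width.eval M ≤ K) : e.Correct d K s := by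
  induction e generalizing d s with
  | const n =>
    refine .of_term rfl rfl rfl ?_ (by simp [opsBound])
    simp only [width, Polynomial.eval_C] at hK
    simpa only [Term.bits] using Nat.succ_le_succ hK
  | len =>
    refine .of_term rfl rfl rfl ?_ (by simp [opsBound])
    simp only [width, Polynomial.eval_X] at hK
    exact Nat.succ_le_succ (hs.len.trans hK)
  | var v =>
    refine .of_term rfl rfl rfl ?_ (by simp [opsBound])
    simp only [width, Polynomial.eval_X] at hK
    exact Nat.succ_le_succ ((hs.var v).trans hK)
  | read a ih =>
    have ha := a.size_value_le hs
    simp only [width, Polynomial.eval_add, Polynomial.eval_X] at hK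
    refine .unary (ih d hs (by omega)) rfl (fun s' hf hv => ⟨?_, ?_⟩) rfl rfl
    · simp only [Term.eval, hv, hf.mem, value, eval]
    · have := hs.mem (a.value s)
      simp only [Term.bits, Term.eval, hv, hf.mem]
      omega
  | add a b iha ihb =>
    have h := (add a b).size_value_le hs
    have ha := a.size_value_le hs
    have hb := b.size_value_le hs
    simp only [width, Polynomial.eval_add, Polynomial.eval_one] at hK h
    refine .binary (iha d hs (by omega)) (fun s' hf => ihb (d + 1) (hs.frame hf) (by omega)) rfl
      (fun s' hv hv' => ⟨?_, ?_⟩) rfl rfl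
    · simp only [Term.eval, hv, hv', value, eval]
    · simp only [Term.bits, Term.eval, hv, hv']
      simp only [value, eval] at *
      omega
  | sub a b iha ihb =>
    have h := (sub a b).size_value_le hs
    have ha := a.size_value_le hs
    have hb := b.size_value_le hs
    simp only [width, Polynomial.eval_add] at hK h
    refine .binary (iha d hs (by omega)) (fun s' hf => ihb (d + 1) (hs.frame hf) (by omega)) rfl
      (fun s' hv hv' => ⟨?_, ?_⟩) rfl rfl
    · simp only [Term.eval, hv, hv', value, eval]
    · simp only [Term.bits, Term.eval, hv, hv']
      simp only [value, eval] at *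
      omega
  | mul a b iha ihb =>
    have h := (mul a b).size_value_le hs
    have ha := a.size_value_le hs
    have hb := b.size_value_le hs
    simp only [width, Polynomial.eval_add] at hK h
    refine .binary (iha d hs (by omega)) (fun s' hf => ihb (d + 1) (hs.frame hf) (by omega)) rfl
      (fun s' hv hv' => ⟨?_, ?_⟩) rfl rfl
    · simp only [Term.eval, hv, hv', value, eval]
    · simp only [Term.bits, Term.eval, hv, hv']
      simp only [value, eval] at *
      omega
  | half a ih =>
    have ha := a.size_value_le hs
    simp only [width] at hK
    refine .unary (ih d hs hK) rfl (fun s' hf hv => ⟨?_, ?_⟩) rfl rfl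
    · simp only [Term.eval, hv, value, eval]
    · have := Nat.size_le_size (Nat.div_le_self (a.value s) 2)
      simp only [Term.bits, Term.eval, hv]
      omega
  | sum v a ih =>
    have hval := (SumExpr.sum v a).size_value_le hs
    simp only [width, Polynomial.eval_add, Polynomial.eval_X, Polynomial.eval_one] at hK hval
    have hvar := hs.var v
    have hr1 := Run.assign (K := K) (s := s) (2 * d + 1) (e := .reg (2 * v + 2))
      (by simp only [Term.bits, Term.ops]; omega)
    simp only [Term.eval, Term.ops] at hr1
    set s₁ : State := { s with reg := Function.update s.reg (2 * d + 1) (s.reg (2 * v + 2)) }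
      with hs₁
    have hf1 : Frame d s s₁ := Frame.update d s _
    have hr2 := Run.assign (K := K) (s := s₁) (2 * (d + 1) + 1) (e := .const 0)
      (by simp [Term.bits, Term.ops])
    simp only [Term.eval, Term.ops] at hr2
    set s₂ : State := { s₁ with reg := Function.update s₁.reg (2 * (d + 1) + 1) 0 } with hs₂
    have hf2 : Frame (d + 1) s₁ s₂ := Frame.update (d + 1) s₁ _
    have hr3 := Run.assign (K := K) (s := s₂) (2 * v + 2) (e := .const 0)
      (by simp [Term.bits, Term.ops])
    simp only [Term.eval, Term.ops] at hr3
    set s₃ : State := { s₂ with reg := Function.update s₂.reg (2 * v + 2) 0 } with hs₃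
    have hodd : ∀ i, s₃.reg (2 * i + 1) = s₂.reg (2 * i + 1) := fun i => by
      rw [hs₃]
      exact Function.update_of_ne (by omega) _ _
    have hf12 := hf1.trans hf2 (by omega)
    obtain ⟨s₄, n₄, hr4, hm4, hl4, hv4, ht4, hval4, hn4⟩ := run_sum_loop (M := M) (K := K) v d
      (fun s hs => ih (d + 2) hs (by omega)) s hs (by omega)
      (s.reg 0) 0 s₃ (by omega)
      hf12.mem
      (by
        have : s₃.reg 0 = s₂.reg 0 := by simp [hs₃]
        rw [this, hf12.len])
      (fun u => by
        by_cases h : u = v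
        · subst h
          simp [hs₃]
        · have : s₃.reg (2 * u + 2) = s₂.reg (2 * u + 2) := by
            rw [hs₃]; exact Function.update_of_ne (by omega) _ _
          rw [this, hf12.var, Function.update_of_ne h])
      (by rw [hodd, hs₂]; simp)
    have hsave : s₄.reg (2 * d + 1) = s.reg (2 * v + 2) := by
      rw [ht4 d (by omega), hodd, hf2.tmp d (by omega), hs₁]
      simp
    have hr5 := Run.assign (K := K) (s := s₄) (2 * v + 2) (e := .reg (2 * d + 1))
      (by simp only [Term.bits, Term.ops, hsave]; omega)
    simp only [Term.eval, Term.ops, hsave] at hr5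
    set s₅ : State := { s₄ with reg := Function.update s₄.reg (2 * v + 2) (s.reg (2 * v + 2)) }
      with hs₅
    have hodd5 : ∀ i, s₅.reg (2 * i + 1) = s₄.reg (2 * i + 1) := fun i => by
      rw [hs₅]
      exact Function.update_of_ne (by omega) _ _
    have hacc : s₅.reg (2 * (d + 1) + 1) = (SumExpr.sum v a).value s := by rw [hodd5, hval4]
    have hr6 := Run.assign (K := K) (s := s₅) (2 * d + 1) (e := .reg (2 * (d + 1) + 1))
      (by simp only [Term.bits, Term.ops, hacc]; omega)
    simp only [Term.eval, Term.ops, hacc] at hr6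
    have hf5 : Frame d s s₅ := by
      refine ⟨hm4, ?_, fun u => ?_, fun j hj => ?_⟩
      · rw [← hl4]
        simp [hs₅]
      · by_cases h : u = v
        · subst h
          simp [hs₅]
        · rw [← hv4 u h, hs₅]
          exact Function.update_of_ne (by omega) _ _
      · rw [hodd5, ht4 j (by omega), hodd, hf12.tmp j hj]
    refine ⟨_, _, hr1.seq (hr2.seq (hr3.seq (hr4.seq (hr5.seq hr6)))),
      hf5.trans (Frame.update d s₅ _) le_rfl, by simp, ?_⟩
    have h12 : (12 : Polynomial ℕ).eval (s.reg 0) = 12 := by simp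
    have h14 : (14 : Polynomial ℕ).eval (s.reg 0) = 14 := by simp
    simp only [opsBound, Polynomial.eval_add, Polynomial.eval_mul, Polynomial.eval_X, h12, h14]
    omega

end SumExpr

theorem monotone_polynomial_eval (p : Polynomial ℕ) : Monotone fun x => p.eval x := by
  intro x y h
  simp only [Polynomial.eval_eq_sum, Polynomial.sum]
  exact Finset.sum_le_sum fun i _ => Nat.mul_le_mul_left _ (Nat.pow_le_pow_left h i)

theorem length_le_bitLength (l : List ℕ) : l.length ≤ bitLength l := by
  induction l with
  | nil => simp
  | cons a l ih =>
    simp only [bitLength, List.length_cons, List.map_cons, List.sum_cons] at *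
    omega

theorem size_lt_bitLength {l : List ℕ} {a : ℕ} (h : a ∈ l) : a.size < bitLength l := by
  have := List.single_le_sum (l := l.map fun n => n.size + 1) (by simp) (a.size + 1)
    (List.mem_map_of_mem h)
  exact this

theorem within_load (l : List ℕ) : Within (bitLength l) (load l) where
  mem a := by
    by_cases h : a < l.length
    · simp only [load, List.getD_eq_getElem _ _ h]
      exact (size_lt_bitLength (List.getElem_mem h)).le
    · have : (load l).mem a = 0 := List.getD_eq_default _ _ (not_lt.1 h)
      simp [this]
  len := by
    have h : l.length.size ≤ l.length := Nat.size_le.2 Nat.lt_two_pow_self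
    exact h.trans (length_le_bitLength l)
  var v := by simp [load]

/-- Every sum expression is computable in strongly polynomial time: the length of the input bounds
the number of iterations of each loop, and numbers only grow by a bounded number of
multiplications. -/
theorem SumExpr.stronglyPolyTime {α : Type} {code : α → List ℕ} {f : α → ℕ} (e : SumExpr)
    (h : ∀ a, e.eval (load (code a)).mem (code a).length (fun _ => 0) = f a) :
    StronglyPolyTime code f := by
  refine ⟨.seq (e.compile 0) (.assign 0 (.reg (2 * 0 + 1))), e.opsBound + 2,
    (e.opsBound + 2) * (e.width + 1), fun a => ?_⟩
  obtain ⟨s', n, hr, hf, hv, hn⟩ := e.correct 0 (within_load (code a)) le_rfl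
  have hval : e.value (load (code a)) = f a := h a
  have hsz := e.size_value_le (within_load (code a))
  have hr2 := Run.assign (K := e.width.eval (bitLength (code a))) (s := s') 0
    (e := .reg (2 * 0 + 1)) (by simp only [Term.bits, Term.ops, hv]; omega)
  obtain ⟨b, hb, hle⟩ := hr.seq hr2
  have hlen : (load (code a)).reg 0 = (code a).length := rfl
  have h2 : ∀ x, (2 : Polynomial ℕ).eval x = 2 := by simp
  simp only [Term.ops] at hb hle
  refine ⟨_, _, _, hb, by simpa [Term.eval, hv] using hval, ?_, hle.trans ?_⟩
  · rw [Polynomial.eval_add, h2, ← hlen]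
    omega
  · rw [Polynomial.eval_mul, Polynomial.eval_add, Polynomial.eval_add, Polynomial.eval_one, h2]
    refine Nat.mul_le_mul_right _ (Nat.add_le_add_right (hn.trans ?_) _)
    rw [hlen]
    exact monotone_polynomial_eval _ (length_le_bitLength _)

theorem StronglyPolyTime.polyTime {α : Type} {code : α → List ℕ} {f : α → ℕ}
    (h : StronglyPolyTime code f) : PolyTime code f := by
  obtain ⟨p, N, B, h⟩ := h
  refine ⟨p, B, fun a => ?_⟩
  obtain ⟨s, n, b, h1, h2, -, h3⟩ := h a
  exact ⟨s, n, b, h1, h2, h3⟩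

end RAM

namespace Imbalance

/-! ### Ranks in finite orders -/

/-- A finite type can be numbered in the order given by an injective key. -/
theorem exists_equiv_fin_lt_iff {V α : Type*} [Fintype V] [LinearOrder α] {f : V → α}
    (hf : Function.Injective f) {n : ℕ} (hn : Fintype.card V = n) :
    ∃ e : V ≃ Fin n, ∀ u v, e u < e v ↔ f u < f v := by
  let _ := LinearOrder.lift' f hf
  exact ⟨(Fintype.orderIsoFinOfCardEq V hn).symm.toEquiv, fun u v =>
    (Fintype.orderIsoFinOfCardEq V hn).symm.lt_iff_lt⟩

theorem card_filter_perm_lt {k d : ℕ} (pos : Equiv.Perm (Fin k)) (hd : d ≤ k) :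
    (Finset.univ.filter fun u => (pos u : ℕ) < d).card = d := by
  have h : (Finset.univ.filter fun u => (pos u : ℕ) < d).map pos.toEmbedding =
      Finset.univ.filter fun u : Fin k => (u : ℕ) < d := by
    ext u
    simp
  rw [← Finset.card_map pos.toEmbedding, h, Fin.card_filter_val_lt, min_eq_right hd]

/-- A set that is downward closed in the order `pos` consists of the elements whose rank is less
than its cardinality. -/
theorem iff_lt_card_filter {k : ℕ} (pos : Equiv.Perm (Fin k)) {p : Fin k → Prop}
    [DecidablePred p] (hp : ∀ u v, pos u < pos v → p v → p u) (u : Fin k) :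
    p u ↔ (pos u : ℕ) < (Finset.univ.filter p).card := by
  constructor
  · intro hu
    rw [Nat.lt_iff_add_one_le]
    conv_lhs => rw [← card_filter_perm_lt (d := (pos u : ℕ) + 1) pos (pos u).isLt]
    refine Finset.card_le_card fun v hv => ?_
    simp only [Finset.mem_filter, Finset.mem_univ, true_and, Nat.lt_succ_iff] at hv ⊢
    rcases hv.lt_or_eq with h | h
    · exact hp v u h hu
    · rwa [pos.injective (Fin.ext h)]
  · intro h
    by_contra hu
    refine h.not_ge ?_
    conv_rhs => rw [← card_filter_perm_lt pos (pos u).isLt.le]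
    refine Finset.card_le_card fun v hv => ?_
    simp only [Finset.mem_filter, Finset.mem_univ, true_and] at hv ⊢
    by_contra hlt
    rcases (not_lt.1 hlt).lt_or_eq with h' | h'
    · exact hu (hp u v h' hv)
    · exact hu (by rwa [pos.injective (Fin.ext h')])

/-! ### The imbalance of a clique at one location -/

/-- The total imbalance of a clique on `l` vertices that are placed consecutively, when the balance
of each of its vertices outside the clique is `δ`. -/
def cliqueSum (l : ℕ) (δ : ℤ) : ℤ := ∑ m ∈ Finset.range l, |δ + l - 1 - 2 * m|

theorem cliqueSum_add_two (l : ℕ) (δ : ℤ) :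
    cliqueSum (l + 2) δ = |δ + l + 1| + cliqueSum l δ + |δ - l - 1| := by
  have h : ∀ m : ℕ, δ + ((l + 2 : ℕ) : ℤ) - 1 - 2 * ((m + 1 : ℕ) : ℤ) = δ + l - 1 - 2 * m := by
    intro m
    push_cast
    ring
  rw [cliqueSum, Finset.sum_range_succ, Finset.sum_range_succ']
  simp only [h, cliqueSum]
  push_cast
  rw [show δ + ((l : ℤ) + 2) - 1 - 0 = δ + l + 1 by ring,
    show δ + (l : ℤ) - 1 - 2 * l = δ - l - 1 by ring]
  ring

theorem cliqueSum_of_ge (δ : ℤ) : ∀ l : ℕ, (l : ℤ) ≤ |δ| + 1 → cliqueSum l δ = l * |δ|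
  | 0, _ => by simp [cliqueSum]
  | 1, _ => by simp [cliqueSum]
  | l + 2, h => by
    push_cast at h
    rw [cliqueSum_add_two, cliqueSum_of_ge δ l (by omega)]
    have : |δ + l + 1| + |δ - l - 1| = 2 * |δ| := by
      simp only [← Int.natCast_natAbs] at *
      omega
    push_cast
    linear_combination this

theorem two_mul_cliqueSum_of_le (δ : ℤ) : ∀ l : ℕ, |δ| ≤ l + 1 →
    2 * cliqueSum l δ = l ^ 2 + δ ^ 2 - (l + δ) % 2
  | 0, h => by
    have h3 : δ = 0 ∨ δ = 1 ∨ δ = -1 := by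
      push_cast at h
      simp only [← Int.natCast_natAbs] at *
      omega
    rcases h3 with rfl | rfl | rfl <;> simp [cliqueSum]
  | 1, h => by
    have h3 : δ = 0 ∨ δ = 1 ∨ δ = -1 ∨ δ = 2 ∨ δ = -2 := by
      push_cast at h
      simp only [← Int.natCast_natAbs] at *
      omega
    rcases h3 with rfl | rfl | rfl | rfl | rfl <;> simp [cliqueSum]
  | l + 2, h => by
    push_cast at h ⊢
    have hpar : ((l : ℤ) + 2 + δ) % 2 = (l + δ) % 2 := by omega
    by_cases hl : |δ| ≤ l + 1
    · have := two_mul_cliqueSum_of_le δ l hl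
      have h2 : |δ + l + 1| + |δ - l - 1| = 2 * (l + 1) := by
        simp only [← Int.natCast_natAbs] at *
        omega
      rw [cliqueSum_add_two, hpar]
      linear_combination this + 2 * h2
    · have := cliqueSum_of_ge δ (l + 2) (by push_cast; omega)
      rw [this, ← sq_abs δ]
      have h3 : |δ| = l + 2 ∨ |δ| = l + 3 := by omega
      have hp : ((l : ℤ) + 2 + δ) % 2 = (l + 2 + |δ|) % 2 := by
        simp only [← Int.natCast_natAbs] at *
        omega
      rw [hp]
      rcases h3 with h3 | h3 <;> rw [h3]
      · rw [show ((l : ℤ) + 2 + (l + 2)) % 2 = 0 by omega]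
        push_cast
        ring
      · rw [show ((l : ℤ) + 2 + (l + 3)) % 2 = 1 by omega]
        push_cast
        ring

/-- A closed form for `cliqueSum` without case distinction. The truncated difference `|δ| - l`
vanishes unless all vertices of the clique lean to the same side. -/
theorem cliqueSum_eq (l : ℕ) (δ : ℤ) :
    cliqueSum l δ =
      ((l * l + δ.natAbs * δ.natAbs - (δ.natAbs - l) * (δ.natAbs - l)) / 2 : ℕ) := by
  rcases le_total δ.natAbs l with h | h
  · have h1 := two_mul_cliqueSum_of_le δ l (by rw [← Int.natCast_natAbs]; omega)
    have h2 : ((l * l + δ.natAbs * δ.natAbs : ℕ) : ℤ) = l ^ 2 + δ ^ 2 := by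
      push_cast
      rw [← sq, ← sq, ← Int.natCast_natAbs, Int.natAbs_sq]
    rw [Nat.sub_eq_zero_of_le h]
    omega
  · have h1 := cliqueSum_of_ge δ l (by rw [← Int.natCast_natAbs]; omega)
    obtain ⟨e, he⟩ := Nat.exists_eq_add_of_le h
    have h2 : l * l + δ.natAbs * δ.natAbs - (δ.natAbs - l) * (δ.natAbs - l) =
        2 * (l * δ.natAbs) := by
      rw [he, Nat.add_sub_cancel_left]
      exact Nat.sub_eq_of_eq_add (by ring)
    rw [h1, h2, Nat.mul_div_cancel_left _ two_pos]
    simp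

open Classical in
/-- The imbalance of a vertex, with every neighbour counted with the sign of its side. -/
theorem vertexImbalance_eq {V : Type} [Fintype V] (G : SimpleGraph V) (σ : Ordering V) (v : V) :
    (vertexImbalance G σ v : ℤ) =
      |∑ u, if G.Adj v u then (if σ v < σ u then 1 else -1) else 0| := by
  rw [vertexImbalance, Int.natCast_natAbs, abs_sub_comm, succs, preds]
  congr 1
  simp only [Finset.card_filter, Nat.cast_sum, ← Finset.sum_sub_distrib]
  refine Finset.sum_congr rfl fun u _ => ?_
  by_cases h : G.Adj v u
  · have hne : σ v ≠ σ u := σ.injective.ne h.ne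
    rcases hne.lt_or_gt with h' | h' <;> simp [h, h', h'.not_gt]
  · simp [h]

namespace Instance

variable (I : Instance)

/-! ### Arbitrary placements of the clique vertices -/

open Classical in
/-- The balance (right minus left) of the twin-cover vertex `s`, when the twin cover is ordered by
`pos` and the vertex `a` of the clique `i` is placed after `loc i a` vertices of the twin cover. -/
noncomputable def coverBalance (pos : Equiv.Perm (Fin I.k)) (loc : ∀ i, Fin (I.size i) → ℕ)
    (s : Fin I.k) : ℤ :=
  (∑ u, if I.H.Adj s u then (if pos s < pos u then 1 else -1) else 0) +
    ∑ i, if s ∈ I.type i then (∑ a, if (pos s : ℕ) < loc i a then 1 else -1) else 0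

/-- The balance in the twin cover of a vertex of the clique `i` that is placed after `d` vertices
of the twin cover. -/
def typeBalance (pos : Equiv.Perm (Fin I.k)) (i : Fin I.r) (d : ℕ) : ℤ :=
  ∑ u, if u ∈ I.type i then (if (pos u : ℕ) < d then -1 else 1) else 0

/-- The imbalance of an ordering of the represented graph, expressed by the order `pos` of the twin
cover, the order `rank i` of each clique, and the locations `loc i a` of the clique vertices. -/
noncomputable def placementCost (pos : Equiv.Perm (Fin I.k))
    (rank : ∀ i, Equiv.Perm (Fin (I.size i))) (loc : ∀ i, Fin (I.size i) → ℕ) : ℤ :=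
  ∑ s, |I.coverBalance pos loc s| +
    ∑ i, ∑ a, |I.typeBalance pos i (loc i a) + I.size i - 1 - 2 * (rank i a : ℕ)|

open Classical in
theorem orderingImbalance_eq_placementCost {σ : Ordering I.Vertex} {pos : Equiv.Perm (Fin I.k)}
    {rank : ∀ i, Equiv.Perm (Fin (I.size i))} {loc : ∀ i, Fin (I.size i) → ℕ}
    (hpos : ∀ u v : Fin I.k, σ (.inl u) < σ (.inl v) ↔ pos u < pos v)
    (hrank : ∀ i (a b : Fin (I.size i)),
      σ (.inr ⟨i, a⟩) < σ (.inr ⟨i, b⟩) ↔ rank i a < rank i b)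
    (hloc : ∀ i a, (Finset.univ.filter fun u : Fin I.k =>
      σ (.inl u) < σ (.inr ⟨i, a⟩)).card = loc i a) :
    (orderingImbalance I.graph σ : ℤ) = I.placementCost pos rank loc := by
  have hside : ∀ (u : Fin I.k) i a, σ (.inl u) < σ (.inr ⟨i, a⟩) ↔ (pos u : ℕ) < loc i a := by
    intro u i a
    rw [← hloc]
    exact iff_lt_card_filter pos (p := fun u => σ (.inl u) < σ (.inr ⟨i, a⟩))
      (fun u v h h' => ((hpos u v).2 h).trans h') u
  have hside' : ∀ (u : Fin I.k) i a, σ (.inr ⟨i, a⟩) < σ (.inl u) ↔ ¬ (pos u : ℕ) < loc i a := by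
    intro u i a
    rw [← hside, not_lt]
    exact ⟨le_of_lt, fun h => h.lt_of_ne (σ.injective.ne (by simp))⟩
  rw [orderingImbalance, Nat.cast_sum, Fintype.sum_sum_type, placementCost, Fintype.sum_sigma]
  congr 1
  · refine Finset.sum_congr rfl fun s _ => ?_
    rw [vertexImbalance_eq, Fintype.sum_sum_type, Fintype.sum_sigma, coverBalance]
    congr 2
    · refine Finset.sum_congr rfl fun u _ => ?_
      simp only [graph, hpos]
    · refine Finset.sum_congr rfl fun i _ => ?_
      by_cases h : s ∈ I.type i <;> simp [graph, hside, h]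
  · refine Finset.sum_congr rfl fun i _ => Finset.sum_congr rfl fun a _ => ?_
    rw [vertexImbalance_eq, Fintype.sum_sum_type, Fintype.sum_sigma,
      Finset.sum_eq_single (a := i)]
    · have h1 : (∑ u : Fin I.k, if I.graph.Adj (.inr ⟨i, a⟩) (.inl u) then
          (if σ (.inr ⟨i, a⟩) < σ (.inl u) then (1 : ℤ) else -1) else 0) =
          I.typeBalance pos i (loc i a) := by
        refine Finset.sum_congr rfl fun u _ => ?_
        simp only [graph, hside', ite_not]
      have h2 : (∑ b, if I.graph.Adj (.inr ⟨i, a⟩) (.inr ⟨i, b⟩) then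
          (if σ (.inr ⟨i, a⟩) < σ (.inr ⟨i, b⟩) then (1 : ℤ) else -1) else 0) =
          I.size i - 1 - 2 * (rank i a : ℕ) := by
        have h3 : ∀ b, (if I.graph.Adj (.inr ⟨i, a⟩) (.inr ⟨i, b⟩) then
            (if σ (.inr ⟨i, a⟩) < σ (.inr ⟨i, b⟩) then (1 : ℤ) else -1) else 0) =
            1 - (if a = b then 1 else 0) -
              2 * (if (rank i b : ℕ) < (rank i a : ℕ) then 1 else 0) := by
          intro b
          by_cases hab : a = b
          · subst hab
            simp [graph]
          · have hne : rank i a ≠ rank i b := (rank i).injective.ne hab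
            rcases hne.lt_or_gt with h | h
            · simp [graph, hab, hrank, h, h.not_gt]
            · simp [graph, hab, hrank, h, h.not_gt]
        simp only [h3, Finset.sum_sub_distrib, ← Finset.mul_sum]
        rw [Finset.sum_boole (fun b => (rank i b : ℕ) < (rank i a : ℕ)),
          card_filter_perm_lt (rank i) (rank i a).isLt.le]
        simp
      rw [h1, h2]
      congr 1
      ring
    · intro j _ hj
      refine Finset.sum_eq_zero fun b _ => if_neg ?_
      rintro ⟨-, h⟩
      exact hj h.symm
    · simp

/-! ### All vertices of a clique at the same location -/

theorem typeBalance_eq_delta (c : I.Certificate) (i : Fin I.r) :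
    I.typeBalance c.pos i (c.loc i) = I.delta c i := by
  rw [delta, Finset.card_filter, Finset.card_filter, typeBalance]
  push_cast
  rw [← Finset.sum_sub_distrib, Finset.sum_ite_mem, Finset.univ_inter]
  refine Finset.sum_congr rfl fun u _ => ?_
  by_cases h : (c.pos u : ℕ) < c.loc i
  · simp [h, h.not_ge]
  · simp [h, not_lt.1 h]

theorem natAbs_delta_le (c : I.Certificate) (i : Fin I.r) : (I.delta c i).natAbs ≤ I.k := by
  have h := Finset.card_filter_add_card_filter_not (s := I.type i)
    fun u => (c.pos u : ℕ) < (c.loc i : ℕ)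
  have h' := Finset.card_le_univ (I.type i)
  simp only [not_lt, Fintype.card_fin] at h h'
  rw [delta]
  omega

theorem nat_ceil_half (m : ℕ) : ⌈(m : ℚ) / 2⌉₊ = (m + 1) / 2 := by
  refine le_antisymm (Nat.ceil_le.2 ?_) ?_
  · have : m ≤ 2 * ((m + 1) / 2) := by omega
    have : (m : ℚ) ≤ 2 * ((m + 1) / 2 : ℕ) := by exact_mod_cast this
    linarith
  · have h := Nat.le_ceil ((m : ℚ) / 2)
    have : (m : ℚ) ≤ (2 * ⌈(m : ℚ) / 2⌉₊ : ℕ) := by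
      push_cast
      linarith
    have := Nat.cast_le.1 this
    omega

/-- The case distinction in `cliqueFormula` only serves to give the same number in closed form. -/
theorem cliqueFormula_eq (c : I.Certificate) (i : Fin I.r) :
    (I.cliqueFormula c i : ℤ) = cliqueSum (I.size i) (I.delta c i) := by
  rw [cliqueFormula]
  split_ifs with hk he
  · rw [← Finset.Ico_add_one_right_eq_Icc, Finset.sum_Ico_eq_sum_range, cliqueSum]
    push_cast
    refine Finset.sum_congr (by simp) fun m _ => ?_
    congr 1
    ring
  all_goals
    have hle := I.natAbs_delta_le c i
    have hsq : (I.delta c i : ℚ) ^ 2 =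
        ((I.delta c i).natAbs * (I.delta c i).natAbs : ℕ) := by
      have : I.delta c i ^ 2 = ((I.delta c i).natAbs * (I.delta c i).natAbs : ℕ) := by
        rw [← Int.natAbs_sq]
        push_cast
        ring
      rw [← Int.cast_pow, this, Int.cast_natCast]
    rw [cliqueSum_eq, show (I.delta c i).natAbs - I.size i = 0 by omega, intrinsic, hsq]
    refine congrArg Nat.cast ?_
  · rw [if_pos he, show (((I.delta c i).natAbs * (I.delta c i).natAbs : ℕ) : ℚ) / 2 =
      (((I.delta c i).natAbs * (I.delta c i).natAbs : ℕ) : ℚ) / (2 : ℕ) by norm_num,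
      Nat.floor_div_eq_div]
    obtain ⟨n, hn⟩ := he
    have : I.size i ^ 2 = 2 * (2 * (n * n)) := by rw [hn]; ring
    have h' : I.size i * I.size i = 2 * (2 * (n * n)) := by rw [← this]; ring
    rw [this, h']
    omega
  · rw [if_neg he, nat_ceil_half]
    obtain ⟨n, hn⟩ := Nat.not_even_iff_odd.1 he
    have : I.size i ^ 2 = 2 * (2 * (n * n + n)) + 1 := by rw [hn]; ring
    have h' : I.size i * I.size i = 2 * (2 * (n * n + n)) + 1 := by rw [← this]; ring
    rw [this, h']
    omega

open Classical in
theorem coverFormula_eq (c : I.Certificate) (s : Fin I.k) :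
    (I.coverFormula c s : ℤ) = |I.coverBalance c.pos (fun i _ => c.loc i) s| := by
  rw [coverFormula, Int.natCast_natAbs, coverBalance, add_sub_assoc]
  congr 2
  · simp only [Finset.card_filter, Nat.cast_sum, ← Finset.sum_sub_distrib]
    refine Finset.sum_congr rfl fun u _ => ?_
    by_cases h : I.H.Adj s u
    · have hne : c.pos s ≠ c.pos u := c.pos.injective.ne h.ne
      rcases hne.lt_or_gt with h' | h' <;> simp [h, h', h'.not_gt]
    · simp [h]
  · simp only [Finset.sum_filter, ← Finset.sum_sub_distrib]
    refine Finset.sum_congr rfl fun i _ => ?_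
    by_cases h : s ∈ I.type i
    · by_cases h' : (c.pos s : ℕ) < c.loc i
      · simp [h, h', h'.not_ge]
      · simp [h, h', not_lt.1 h']
    · simp [h]

theorem placementCost_certificate (c : I.Certificate)
    (rank : ∀ i, Equiv.Perm (Fin (I.size i))) :
    I.placementCost c.pos rank (fun i _ => c.loc i) = I.formula c := by
  rw [formula, placementCost]
  push_cast
  congr 1
  · exact Finset.sum_congr rfl fun s _ => (I.coverFormula_eq c s).symm
  · refine Finset.sum_congr rfl fun i _ => ?_
    rw [cliqueFormula_eq, cliqueSum, I.typeBalance_eq_delta,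
      Equiv.sum_comp (rank i) fun a : Fin (I.size i) =>
        |I.delta c i + I.size i - 1 - 2 * ((a : ℕ) : ℤ)|,
      Fin.sum_univ_eq_sum_range fun m => |I.delta c i + I.size i - 1 - 2 * (m : ℤ)|]

/-! ### Gathering every clique at one location -/

/-- Whether moving a clique vertex between the locations `d` and `d'` moves it past `u`. -/
def crossing (pos : Equiv.Perm (Fin I.k)) (d d' : ℕ) (u : Fin I.k) : ℤ :=
  if ((pos u : ℕ) < d ↔ (pos u : ℕ) < d') then 0 else 1

/-- The number of neighbours that a vertex of the clique `i` passes on its way between the locations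
`d` and `d'`. -/
def crossings (pos : Equiv.Perm (Fin I.k)) (i : Fin I.r) (d d' : ℕ) : ℤ :=
  ∑ u, if u ∈ I.type i then I.crossing pos d d' u else 0

theorem typeBalance_sub (pos : Equiv.Perm (Fin I.k)) (i : Fin I.r) {d d' : ℕ} (h : d ≤ d') :
    I.typeBalance pos i d - I.typeBalance pos i d' = 2 * I.crossings pos i d d' := by
  rw [typeBalance, typeBalance, crossings, ← Finset.sum_sub_distrib, Finset.mul_sum]
  refine Finset.sum_congr rfl fun u _ => ?_
  by_cases hu : u ∈ I.type i
  · by_cases h1 : (pos u : ℕ) < d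
    · simp [hu, crossing, h1, h1.trans_le h]
    · by_cases h2 : (pos u : ℕ) < d' <;> simp [hu, crossing, h1, h2]
  · simp [hu]

theorem crossings_comm (pos : Equiv.Perm (Fin I.k)) (i : Fin I.r) (d d' : ℕ) :
    I.crossings pos i d d' = I.crossings pos i d' d := by
  simp only [crossings, crossing, iff_comm]

theorem crossings_succ_le (pos : Equiv.Perm (Fin I.k)) (i : Fin I.r) {d : ℕ} (hd : d < I.k) :
    I.crossings pos i d (d + 1) ≤ 1 := by
  calc I.crossings pos i d (d + 1)
      ≤ ∑ u, if pos u = (⟨d, hd⟩ : Fin I.k) then (1 : ℤ) else 0 := by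
        refine Finset.sum_le_sum fun u _ => ?_
        simp only [crossing, Fin.ext_iff]
        split_ifs <;> omega
    _ = ∑ u, if u = (⟨d, hd⟩ : Fin I.k) then (1 : ℤ) else 0 :=
        Equiv.sum_comp pos fun u => if u = (⟨d, hd⟩ : Fin I.k) then (1 : ℤ) else 0
    _ ≤ 1 := by simp

/-- There is a location at which a clique can be gathered such that every clique vertex on the left
of it keeps at least as many neighbours on its right as on its left until it has arrived, and
conversely. Hence each crossing of a neighbour lowers the imbalance of the clique vertex by `2`. -/
theorem exists_gathering_location (pos : Equiv.Perm (Fin I.k)) (i : Fin I.r)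
    (rank : Equiv.Perm (Fin (I.size i))) {loc : Fin (I.size i) → ℕ} (hle : ∀ a, loc a ≤ I.k)
    (hmono : ∀ a b, rank a < rank b → loc a ≤ loc b) :
    ∃ d : Fin (I.k + 1), ∀ a,
      |I.typeBalance pos i d + I.size i - 1 - 2 * (rank a : ℕ)| +
          2 * I.crossings pos i (loc a) d =
        |I.typeBalance pos i (loc a) + I.size i - 1 - 2 * (rank a : ℕ)| := by
  classical
  -- The last location such that no clique vertex before it gets more neighbours on its left than
  -- on its right by moving there.
  let P : ℕ → Prop := fun d => ∀ a, loc a < d →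
    0 ≤ I.typeBalance pos i d + I.size i - 1 - 2 * (rank a : ℕ)
  obtain ⟨d, hd⟩ : ∃ d, d = Nat.findGreatest P I.k := ⟨_, rfl⟩
  have hdk : d ≤ I.k := hd ▸ Nat.findGreatest_le I.k
  have hP : P d := by
    rw [hd]
    exact Nat.findGreatest_spec (P := P) (Nat.zero_le I.k) fun a ha => absurd ha (Nat.not_lt_zero _)
  have hQ : ∀ a, d < loc a → I.typeBalance pos i d + I.size i - 1 - 2 * (rank a : ℕ) ≤ 0 := by
    intro a ha
    have hlt : d < I.k := ha.trans_le (hle a)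
    have hnP : ¬ P (d + 1) :=
      Nat.findGreatest_is_greatest (P := P) (by rw [← hd]; exact Nat.lt_succ_self d) hlt
    simp only [P, not_forall, not_le] at hnP
    obtain ⟨b, hb, hneg⟩ := hnP
    have hab : rank b < rank a := by
      rcases lt_trichotomy (rank b) (rank a) with h | h | h
      · exact h
      · rw [rank.injective h] at hb
        omega
      · have := hmono a b h
        omega
    rw [Fin.lt_def] at hab
    have h1 := I.typeBalance_sub pos i (Nat.le_succ d)
    have h2 := I.crossings_succ_le pos i hlt
    rw [Nat.succ_eq_add_one] at h1
    omega
  refine ⟨⟨d, Nat.lt_succ_of_le hdk⟩, fun a => ?_⟩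
  have hnn : ∀ d d', 0 ≤ I.crossings pos i d d' := fun d d' =>
    Finset.sum_nonneg fun u _ => by rw [crossing]; split_ifs <;> norm_num
  have hn := hnn (loc a) d
  simp only
  rcases lt_trichotomy (loc a) d with h | h | h
  · have h1 := I.typeBalance_sub pos i h.le
    have h2 := hP a h
    rw [abs_of_nonneg h2, abs_of_nonneg (by omega)]
    omega
  · have h1 := I.typeBalance_sub pos i h.le
    rw [h] at h1 ⊢
    omega
  · have h1 := I.typeBalance_sub pos i h.le
    have h2 := hQ a h
    rw [I.crossings_comm] at hn ⊢
    rw [abs_of_nonpos h2, abs_of_nonpos (by omega)]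
    omega

/-- Moving clique vertices changes the imbalance of a twin-cover vertex by at most `2` for each
neighbour that is moved past it. -/
theorem abs_coverBalance_le (pos : Equiv.Perm (Fin I.k)) (loc loc' : ∀ i, Fin (I.size i) → ℕ)
    (s : Fin I.k) :
    |I.coverBalance pos loc' s| ≤ |I.coverBalance pos loc s| +
      ∑ i, ∑ a, 2 * (if s ∈ I.type i then I.crossing pos (loc i a) (loc' i a) s else 0) := by
  have h : I.coverBalance pos loc' s = I.coverBalance pos loc s + ∑ i, ∑ a,
      if s ∈ I.type i then ((if (pos s : ℕ) < loc' i a then (1 : ℤ) else -1) -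
        (if (pos s : ℕ) < loc i a then 1 else -1)) else 0 := by
    rw [coverBalance, coverBalance, add_assoc, ← Finset.sum_add_distrib]
    congr 1
    refine Finset.sum_congr rfl fun i _ => ?_
    by_cases hs : s ∈ I.type i
    · simp [hs]
    · simp [hs]
  rw [h]
  refine (abs_add_le _ _).trans (add_le_add le_rfl ?_)
  refine (Finset.abs_sum_le_sum_abs _ _).trans (Finset.sum_le_sum fun i _ => ?_)
  refine (Finset.abs_sum_le_sum_abs _ _).trans (Finset.sum_le_sum fun a _ => ?_)
  rw [crossing]
  by_cases hs : s ∈ I.type i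
  · by_cases h1 : (pos s : ℕ) < loc i a <;> by_cases h2 : (pos s : ℕ) < loc' i a <;>
      simp [hs, h1, h2]
  · simp [hs]

/-- Gathering all cliques at suitable locations does not increase the imbalance: what the crossings
cost the twin cover, they gain for the cliques. -/
theorem exists_placementCost_le (pos : Equiv.Perm (Fin I.k))
    (rank : ∀ i, Equiv.Perm (Fin (I.size i))) {loc : ∀ i, Fin (I.size i) → ℕ}
    (hle : ∀ i a, loc i a ≤ I.k) (hmono : ∀ i a b, rank i a < rank i b → loc i a ≤ loc i b) :
    ∃ d : Fin I.r → Fin (I.k + 1),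
      I.placementCost pos rank (fun i _ => d i) ≤ I.placementCost pos rank loc := by
  choose d hd using fun i => I.exists_gathering_location pos i (rank i) (hle i) (hmono i)
  refine ⟨d, ?_⟩
  have h1 := Finset.sum_le_sum fun s (_ : s ∈ Finset.univ) =>
    I.abs_coverBalance_le pos loc (fun i _ => d i) s
  have h2 : ∑ s, ∑ i, ∑ a : Fin (I.size i),
      2 * (if s ∈ I.type i then I.crossing pos (loc i a) (d i) s else 0) =
      ∑ i, ∑ a, 2 * I.crossings pos i (loc i a) (d i) := by
    rw [Finset.sum_comm]
    refine Finset.sum_congr rfl fun i _ => ?_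
    rw [Finset.sum_comm]
    refine Finset.sum_congr rfl fun a _ => ?_
    rw [crossings, Finset.mul_sum]
  rw [Finset.sum_add_distrib, h2] at h1
  simp only [placementCost, ← hd, Finset.sum_add_distrib]
  linarith

/-! ### Certificates and orderings -/

theorem exists_perm_rank {α : Type*} [LinearOrder α] {n : ℕ} {f : Fin n → α}
    (hf : Function.Injective f) : ∃ e : Equiv.Perm (Fin n), ∀ a b, f a < f b ↔ e a < e b := by
  obtain ⟨e, he⟩ := exists_equiv_fin_lt_iff hf (Fintype.card_fin n)
  exact ⟨e, fun a b => (he a b).symm⟩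

theorem exists_ranks (σ : Ordering I.Vertex) : ∃ rank : ∀ i, Equiv.Perm (Fin (I.size i)),
    ∀ i (a b : Fin (I.size i)), σ (.inr ⟨i, a⟩) < σ (.inr ⟨i, b⟩) ↔ rank i a < rank i b := by
  choose rank hrank using fun i => exists_perm_rank
    (f := fun a : Fin (I.size i) => σ (.inr ⟨i, a⟩))
    fun a b h => by simpa using σ.injective h
  exact ⟨rank, hrank⟩

theorem exists_perm_cover (σ : Ordering I.Vertex) : ∃ pos : Equiv.Perm (Fin I.k),
    ∀ u v : Fin I.k, σ (.inl u) < σ (.inl v) ↔ pos u < pos v :=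
  exists_perm_rank (f := fun u : Fin I.k => σ (.inl u)) fun a b h => by simpa using σ.injective h

/-- The imbalance of an ordering is given by the closed formulas as soon as every clique lies
between two consecutive vertices of the twin cover; other cliques may be interspersed. -/
theorem orderingImbalance_eq_formula {σ : Ordering I.Vertex} {c : I.Certificate}
    (h : I.Realizes σ c) : orderingImbalance I.graph σ = I.formula c := by
  obtain ⟨rank, hrank⟩ := I.exists_ranks σ
  have h1 := I.orderingImbalance_eq_placementCost h.1 hrank (loc := fun i _ => c.loc i) h.2
  rw [placementCost_certificate] at h1
  exact_mod_cast h1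

/-- Every ordering can be replaced by a certificate of at most the same value. -/
theorem exists_formula_le (σ : Ordering I.Vertex) :
    ∃ c : I.Certificate, I.formula c ≤ orderingImbalance I.graph σ := by
  classical
  obtain ⟨rank, hrank⟩ := I.exists_ranks σ
  obtain ⟨pos, hpos⟩ := I.exists_perm_cover σ
  have h1 := I.orderingImbalance_eq_placementCost hpos hrank fun _ _ => rfl
  obtain ⟨d, hd⟩ := I.exists_placementCost_le pos rank
    (loc := fun i a => (Finset.univ.filter fun u : Fin I.k =>
      σ (.inl u) < σ (.inr ⟨i, a⟩)).card)
    (fun i a => (Finset.card_le_univ _).trans_eq (Fintype.card_fin _))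
    (fun i a b hab => Finset.card_le_card fun u hu => by
      simp only [Finset.mem_filter, Finset.mem_univ, true_and] at hu ⊢
      exact hu.trans ((hrank i a b).2 hab))
  refine ⟨⟨pos, d⟩, ?_⟩
  have h2 := I.placementCost_certificate ⟨pos, d⟩ rank
  have h3 : (I.formula ⟨pos, d⟩ : ℤ) ≤ orderingImbalance I.graph σ := by
    rw [← h2, h1]
    convert hd
  exact_mod_cast h3

/-- The sorting key of the clean ordering that belongs to a certificate: cliques at location `d`
are put between the twin-cover vertices of ranks `d - 1` and `d`, one clique after the other. -/
def cleanKey (c : I.Certificate) : I.Vertex → ℕ ×ₗ ℕ ×ₗ ℕ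
  | .inl u => toLex (2 * (c.pos u : ℕ) + 1, toLex (0, 0))
  | .inr x => toLex (2 * (c.loc x.1 : ℕ), toLex ((x.1 : ℕ), (x.2 : ℕ)))

theorem cleanKey_injective (c : I.Certificate) : Function.Injective (I.cleanKey c) := by
  rintro (u | ⟨i, a⟩) (v | ⟨j, b⟩) h
  · simp only [cleanKey, EmbeddingLike.apply_eq_iff_eq, Prod.mk.injEq] at h
    exact congrArg Sum.inl (c.pos.injective (Fin.ext (by omega)))
  · simp only [cleanKey, EmbeddingLike.apply_eq_iff_eq, Prod.mk.injEq] at h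
    omega
  · simp only [cleanKey, EmbeddingLike.apply_eq_iff_eq, Prod.mk.injEq] at h
    omega
  · simp only [cleanKey, EmbeddingLike.apply_eq_iff_eq, Prod.mk.injEq] at h
    obtain rfl := Fin.ext h.2.1
    obtain rfl := Fin.ext h.2.2
    rfl

theorem exists_clean_realizes (c : I.Certificate) :
    ∃ σ : Ordering I.Vertex, I.IsClean σ ∧ I.Realizes σ c := by
  obtain ⟨σ, hσ⟩ := exists_equiv_fin_lt_iff (I.cleanKey_injective c) rfl
  refine ⟨σ, ?_, ?_, ?_⟩
  · intro i a b z h1 h2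
    rw [hσ] at h1 h2
    rcases z with u | ⟨j, d⟩
    · simp only [cleanKey, Prod.Lex.toLex_lt_toLex] at h1 h2
      omega
    · simp only [cleanKey, Prod.Lex.toLex_lt_toLex] at h1 h2
      obtain rfl : j = i := Fin.ext (by omega)
      exact ⟨d, rfl⟩
  · intro u v
    rw [hσ, Fin.lt_def]
    simp only [cleanKey, Prod.Lex.toLex_lt_toLex]
    omega
  · intro i a
    rw [← card_filter_perm_lt c.pos (Nat.le_of_lt_succ (c.loc i).isLt)]
    congr 1
    ext u
    simp only [Finset.mem_filter, Finset.mem_univ, true_and, hσ, cleanKey,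
      Prod.Lex.toLex_lt_toLex]
    omega

theorem IsClean.exists_realizes {I : Instance} {σ : Ordering I.Vertex} (h : I.IsClean σ) :
    ∃ c : I.Certificate, I.Realizes σ c := by
  classical
  obtain ⟨pos, hpos⟩ := I.exists_perm_cover σ
  refine ⟨⟨pos, fun i => ⟨(Finset.univ.filter fun u : Fin I.k =>
    σ (.inl u) < σ (.inr ⟨i, ⟨0, I.size_pos i⟩⟩)).card, Nat.lt_succ_of_le
      ((Finset.card_le_univ _).trans_eq (Fintype.card_fin _))⟩⟩, hpos, fun i a => ?_⟩
  -- A vertex of the twin cover cannot separate two vertices of the same clique.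
  have key : ∀ (a b : Fin (I.size i)) (u : Fin I.k),
      σ (.inl u) < σ (.inr ⟨i, a⟩) → σ (.inl u) < σ (.inr ⟨i, b⟩) := by
    intro a b u hu
    by_contra hb
    have hne : σ (.inr ⟨i, b⟩) ≠ σ (.inl u) := σ.injective.ne (by simp)
    obtain ⟨c, hc⟩ := h i b a _ ((not_lt.1 hb).lt_of_ne hne) hu
    simp at hc
  simp only
  congr 1
  ext u
  simp only [Finset.mem_filter, Finset.mem_univ, true_and]
  exact ⟨key _ _ u, key _ _ u⟩

theorem isYes_iff : I.IsYes ↔ ∃ c : I.Certificate, I.formula c ≤ I.target := by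
  rw [IsYes, graphImbalance]
  constructor
  · intro h
    have : Nonempty (Ordering I.Vertex) := ⟨Fintype.equivFin _⟩
    obtain ⟨σ, hσ⟩ := Nat.sInf_mem
      (Set.range_nonempty fun σ : Ordering I.Vertex => orderingImbalance I.graph σ)
    obtain ⟨c, hc⟩ := I.exists_formula_le σ
    exact ⟨c, hc.trans (hσ.trans_le h)⟩
  · rintro ⟨c, hc⟩
    obtain ⟨σ, -, hσ⟩ := I.exists_clean_realizes c
    exact (Nat.sInf_le (Set.mem_range_self σ)).trans ((I.orderingImbalance_eq_formula hσ).trans_le hc)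

/-! ### Encodings -/

theorem length_flatMap_finRange {k : ℕ} {α : Type*} (l : List α) (f : α → Fin k → ℕ) :
    (l.flatMap fun i => (List.finRange k).map (f i)).length = l.length * k := by
  induction l with
  | nil => simp
  | cons a l ih => simp [ih, add_mul, add_comm]

theorem getD_flatMap_finRange {k : ℕ} {α : Type*} (l : List α) (f : α → Fin k → ℕ) {n : ℕ}
    (hn : n < l.length) (j : Fin k) :
    (l.flatMap fun i => (List.finRange k).map (f i)).getD (n * k + j) 0 = f l[n] j := by
  induction l generalizing n with
  | nil => simp at hn
  | cons a l ih =>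
    rw [List.flatMap_cons]
    cases n with
    | zero =>
      rw [List.getD_append _ _ _ _ (by simp)]
      simp
    | succ n =>
      rw [List.getD_append_right _ _ _ _ (by simp [add_mul]; omega)]
      have : (n + 1) * k + j - ((List.finRange k).map (f a)).length = n * k + j := by
        simp [add_mul]
        omega
      rw [this, ih (by simpa using hn)]
      simp

theorem getD_map_finRange {n : ℕ} (f : Fin n → ℕ) (i : Fin n) :
    ((List.finRange n).map f).getD i 0 = f i := by
  simp

theorem length_code : I.code.length = 3 + I.k * I.k + I.r + I.r * I.k := by
  simp only [code, List.length_append, length_flatMap_finRange, List.length_map,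
    List.length_finRange, List.length_cons, List.length_nil]

theorem Certificate.length_code {I : Instance} (c : I.Certificate) :
    c.code.length = I.k + I.r := by
  simp [Certificate.code]

theorem Certificate.le_of_mem_code {I : Instance} (c : I.Certificate) {n : ℕ} (h : n ∈ c.code) :
    n ≤ I.k := by
  simp only [Certificate.code, List.mem_append, List.mem_map, List.mem_finRange, true_and] at h
  rcases h with ⟨u, rfl⟩ | ⟨i, rfl⟩
  · exact (c.pos u).isLt.le
  · exact Nat.le_of_lt_succ (c.loc i).isLt

theorem Certificate.bitLength_code_le {I : Instance} (c : I.Certificate) :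
    RAM.bitLength c.code ≤ (Polynomial.X ^ 2 : Polynomial ℕ).eval (RAM.bitLength I.code) := by
  have h1 : RAM.bitLength c.code ≤ c.code.length * (I.k.size + 1) := by
    have := List.sum_le_card_nsmul (c.code.map fun n => n.size + 1) (I.k.size + 1) (by
      intro a ha
      obtain ⟨n, hn, rfl⟩ := List.mem_map.1 ha
      exact Nat.succ_le_succ (Nat.size_le_size (c.le_of_mem_code hn)))
    simpa [RAM.bitLength] using this
  have h2 : c.code.length ≤ RAM.bitLength I.code := by
    refine le_trans ?_ (RAM.length_le_bitLength _)
    rw [c.length_code, I.length_code]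
    have := Nat.le_mul_self I.k
    omega
  have h3 : I.k.size + 1 ≤ RAM.bitLength I.code :=
    RAM.size_lt_bitLength (show I.k ∈ I.code by simp [Instance.code])
  rw [Polynomial.eval_pow, Polynomial.eval_X, sq]
  exact h1.trans (Nat.mul_le_mul h2 h3)

open Classical in
/-- The memory `m` holds the encoding of the instance `I`, preceded by its length and followed by
the encoding of the certificate `c`. -/
structure Layout (m : ℕ → ℕ) (c : I.Certificate) : Prop where
  length : m 0 = 3 + I.k * I.k + I.r + I.r * I.k
  k : m 1 = I.k
  r : m 2 = I.r
  target : m 3 = I.target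
  adj : ∀ u v : Fin I.k, m (4 + (u * I.k + v)) = if I.H.Adj u v then 1 else 0
  size : ∀ i : Fin I.r, m (4 + I.k * I.k + i) = I.size i
  type : ∀ (i : Fin I.r) (u : Fin I.k),
    m (4 + I.k * I.k + I.r + (i * I.k + u)) = if u ∈ I.type i then 1 else 0
  pos : ∀ u : Fin I.k, m (4 + I.k * I.k + I.r + I.r * I.k + u) = c.pos u
  loc : ∀ i : Fin I.r, m (4 + I.k * I.k + I.r + I.r * I.k + I.k + i) = c.loc i

theorem layout_pairCode (c : I.Certificate) :
    I.Layout (RAM.load (RAM.pairCode I.code c.code)).mem c := by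
  classical
  have hmem : ∀ n, (RAM.load (RAM.pairCode I.code c.code)).mem (1 + n) =
      (I.code ++ c.code).getD n 0 := fun n => by
    rw [add_comm]
    rfl
  have hx : ∀ {n}, n < 3 + I.k * I.k + I.r + I.r * I.k →
      (RAM.load (RAM.pairCode I.code c.code)).mem (1 + n) = I.code.getD n 0 := fun {n} h => by
    rw [hmem, List.getD_append _ _ _ _ (by rwa [length_code])]
  have hy : ∀ n, (RAM.load (RAM.pairCode I.code c.code)).mem
      (1 + (3 + I.k * I.k + I.r + I.r * I.k + n)) = c.code.getD n 0 := fun n => by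
    rw [hmem, List.getD_append_right _ _ _ _ (by rw [length_code]; omega), length_code,
      Nat.add_sub_cancel_left]
  have hlt : ∀ {a b : ℕ} (i : Fin a) (j : Fin b), i * b + j < a * b := by
    intro a b i j
    calc i * b + j < (i + 1) * b := by rw [add_mul]; omega
      _ ≤ a * b := Nat.mul_le_mul_right _ i.isLt
  have hadj : ∀ u v : Fin I.k, ((List.finRange I.k).flatMap fun u =>
      (List.finRange I.k).map fun v => if I.H.Adj u v then 1 else 0).getD (u * I.k + v) 0 =
      if I.H.Adj u v then 1 else 0 := by
    intro u v
    rw [getD_flatMap_finRange (n := u) _ (fun u v => if I.H.Adj u v then 1 else 0) (by simp)]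
    simp
  have htype : ∀ (i : Fin I.r) (u : Fin I.k), ((List.finRange I.r).flatMap fun i =>
      (List.finRange I.k).map fun u => if u ∈ I.type i then 1 else 0).getD (i * I.k + u) 0 =
      if u ∈ I.type i then 1 else 0 := by
    intro i u
    rw [getD_flatMap_finRange (n := i) _ (fun i u => if u ∈ I.type i then 1 else 0) (by simp)]
    simp
  refine ⟨I.length_code, rfl, rfl, rfl, fun u v => ?_, fun i => ?_, fun i u => ?_, fun u => ?_,
    fun i => ?_⟩
  · have h := hlt u v
    rw [show 4 + (u * I.k + v) = 1 + (3 + (u * I.k + v) : ℕ) by omega, hx (by omega), ← hadj,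
      code, List.getD_append _ _ _ _ (by simp; omega),
      List.getD_append _ _ _ _ (by simp; omega),
      List.getD_append_right _ _ _ _ (by simp)]
    congr 1
    simp
  · rw [show 4 + I.k * I.k + i = 1 + (3 + I.k * I.k + i : ℕ) by omega, hx (by omega),
      ← getD_map_finRange I.size, code,
      List.getD_append _ _ _ _ (by simp; omega),
      List.getD_append_right _ _ _ _ (by simp; omega)]
    congr 1
    simp
    omega
  · have h := hlt i u
    rw [show 4 + I.k * I.k + I.r + (i * I.k + u) =
      1 + (3 + I.k * I.k + I.r + (i * I.k + u) : ℕ) by omega, hx (by omega), ← htype, code,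
      List.getD_append_right _ _ _ _ (by simp; omega)]
    congr 1
    simp
    omega
  · rw [show 4 + I.k * I.k + I.r + I.r * I.k + u =
      1 + (3 + I.k * I.k + I.r + I.r * I.k + u : ℕ) by omega, hy, Certificate.code,
      List.getD_append _ _ _ _ (by simp), getD_map_finRange fun u => (c.pos u : ℕ)]
  · rw [show 4 + I.k * I.k + I.r + I.r * I.k + I.k + i =
      1 + (3 + I.k * I.k + I.r + I.r * I.k + (I.k + i) : ℕ) by omega, hy, Certificate.code,
      List.getD_append_right _ _ _ _ (by simp)]
    simp

/-- The encodings of `I` and `c` are determined by what the memory has to hold. -/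
theorem Layout.unique {I : Instance} {c : I.Certificate} {m m' : ℕ → ℕ} (h : I.Layout m c)
    (h' : I.Layout m' c) {n : ℕ} (hn : n < 4 + I.k * I.k + I.r + I.r * I.k + I.k + I.r) :
    m n = m' n := by
  have hgrid : ∀ a b : ℕ, a < b * I.k →
      ∃ (i : Fin b) (j : Fin I.k), a = i * I.k + j := by
    intro a b hab
    have hk : 0 < I.k := Nat.pos_of_ne_zero fun h0 => by simp [h0] at hab
    exact ⟨⟨a / I.k, Nat.div_lt_of_lt_mul (by rwa [mul_comm])⟩, ⟨a % I.k, Nat.mod_lt _ hk⟩,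
      (Nat.div_add_mod' a I.k).symm⟩
  by_cases h4 : n < 4
  · interval_cases n
    · rw [h.length, h'.length]
    · rw [h.k, h'.k]
    · rw [h.r, h'.r]
    · rw [h.target, h'.target]
  obtain ⟨n, rfl⟩ := Nat.exists_eq_add_of_le (not_lt.1 h4)
  by_cases h5 : n < I.k * I.k
  · obtain ⟨u, v, rfl⟩ := hgrid n _ h5
    rw [h.adj, h'.adj]
  obtain ⟨n, rfl⟩ := Nat.exists_eq_add_of_le (not_lt.1 h5)
  rw [← add_assoc] at *
  by_cases h6 : n < I.r
  · exact (h.size ⟨n, h6⟩).trans (h'.size ⟨n, h6⟩).symm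
  obtain ⟨n, rfl⟩ := Nat.exists_eq_add_of_le (not_lt.1 h6)
  rw [← add_assoc] at *
  by_cases h7 : n < I.r * I.k
  · obtain ⟨i, u, rfl⟩ := hgrid n _ h7
    rw [h.type, h'.type]
  obtain ⟨n, rfl⟩ := Nat.exists_eq_add_of_le (not_lt.1 h7)
  rw [← add_assoc] at *
  by_cases h8 : n < I.k
  · exact (h.pos ⟨n, h8⟩).trans (h'.pos ⟨n, h8⟩).symm
  obtain ⟨n, rfl⟩ := Nat.exists_eq_add_of_le (not_lt.1 h8)
  rw [← add_assoc] at *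
  have h9 : n < I.r := by omega
  exact (h.loc ⟨n, h9⟩).trans (h'.loc ⟨n, h9⟩).symm

theorem Layout.eq_code {I : Instance} {c : I.Certificate} {x y : List ℕ}
    (h : I.Layout (RAM.load (RAM.pairCode x y)).mem c) (hy : y.length = I.k + I.r) :
    I.code = x ∧ c.code = y := by
  have hx : x.length = 3 + I.k * I.k + I.r + I.r * I.k := h.length
  have heq : RAM.pairCode I.code c.code = RAM.pairCode x y := by
    refine List.ext_getElem (by simp [RAM.pairCode, hx, hy, I.length_code, c.length_code])
      fun n h1 h2 => ?_
    have := (I.layout_pairCode c).unique h (n := n) (by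
      simp only [RAM.pairCode, List.length_cons, List.length_append, hx, hy] at h2
      omega)
    simpa [RAM.load, List.getElem?_eq_getElem h1, List.getElem?_eq_getElem h2] using this
  exact List.append_inj (List.cons.inj heq).2 (by rw [I.length_code, hx])

end Instance

end Imbalance

namespace RAM.SumExpr

/-! ### Derived expressions -/

/-- The indicator of `a < b`. -/
def lt (a b : SumExpr) : SumExpr := .sub (.const 1) (.sub (.const 1) (.sub b a))

/-- The indicator of `a ≤ b`. -/
def le (a b : SumExpr) : SumExpr := .sub (.const 1) (.sub a b)

/-- The distance `|a - b|`. -/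
def dist (a b : SumExpr) : SumExpr := .add (.sub a b) (.sub b a)

/-- The sum of `a` over all values of the variable `v` below `n`, provided that `n` is at most the
length of the input. -/
def sumTo (v : ℕ) (n a : SumExpr) : SumExpr := .sum v (.mul (lt (.var v) n) a)

variable {m : ℕ → ℕ} {L : ℕ} {ρ : ℕ → ℕ}

@[simp] theorem eval_lt (a b : SumExpr) :
    (lt a b).eval m L ρ = if a.eval m L ρ < b.eval m L ρ then 1 else 0 := by
  simp only [lt, eval]
  split_ifs <;> omega

@[simp] theorem eval_le (a b : SumExpr) :
    (le a b).eval m L ρ = if a.eval m L ρ ≤ b.eval m L ρ then 1 else 0 := by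
  simp only [le, eval]
  split_ifs <;> omega

theorem eval_dist (a b : SumExpr) :
    (dist a b).eval m L ρ = ((a.eval m L ρ : ℤ) - b.eval m L ρ).natAbs := by
  simp only [dist, eval]
  omega

@[simp] theorem eval_dist_eq_zero (a b : SumExpr) :
    (dist a b).eval m L ρ = 0 ↔ a.eval m L ρ = b.eval m L ρ := by
  simp only [dist, eval]
  omega

theorem eval_sumTo {v : ℕ} {n a : SumExpr} {N : ℕ}
    (hn : ∀ x, n.eval m L (Function.update ρ v x) = N) (hN : N ≤ L) :
    (sumTo v n a).eval m L ρ = ∑ x : Fin N, a.eval m L (Function.update ρ v x) := by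
  rw [← Finset.sum_range fun x => a.eval m L (Function.update ρ v x)]
  simp only [sumTo, eval, eval_lt, hn, Function.update_self, ite_mul, one_mul, zero_mul]
  rw [← Finset.sum_filter]
  congr 1
  ext x
  simp only [Finset.mem_filter, Finset.mem_range]
  omega

end RAM.SumExpr

namespace Imbalance

open RAM (SumExpr)
open RAM.SumExpr (lt le dist sumTo eval_lt eval_le eval_dist eval_dist_eq_zero eval_sumTo)

/-! ### The value of a certificate as a sum expression -/

namespace Code

/-- The number of twin-cover vertices. -/
def k : SumExpr := .read (.const 1)

/-- The number of cliques. -/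
def r : SumExpr := .read (.const 2)

/-- The target. -/
def target : SumExpr := .read (.const 3)

/-- The address of the clique sizes. -/
def sizeBase : SumExpr := .add (.const 4) (.mul k k)

/-- The address of the types. -/
def typeBase : SumExpr := .add sizeBase r

/-- The address of the positions. -/
def posBase : SumExpr := .add typeBase (.mul r k)

/-- The address of the locations. -/
def locBase : SumExpr := .add posBase k

/-- The entry `(u, v)` of the adjacency matrix. -/
def adj (u v : SumExpr) : SumExpr := .read (.add (.const 4) (.add (.mul u k) v))

/-- The size of the clique `i`. -/
def size (i : SumExpr) : SumExpr := .read (.add sizeBase i)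

/-- The indicator of `u` being in the type of the clique `i`. -/
def type (i u : SumExpr) : SumExpr := .read (.add typeBase (.add (.mul i k) u))

/-- The position of `u`. -/
def pos (u : SumExpr) : SumExpr := .read (.add posBase u)

/-- The location of the clique `i`. -/
def loc (i : SumExpr) : SumExpr := .read (.add locBase i)

section Eval

variable (m : ℕ → ℕ) (L : ℕ) (ρ : ℕ → ℕ)

theorem eval_k : k.eval m L ρ = m 1 := rfl

theorem eval_r : r.eval m L ρ = m 2 := rfl

theorem eval_adj (u v : SumExpr) : (adj u v).eval m L ρ =
    m (4 + (u.eval m L ρ * m 1 + v.eval m L ρ)) := rfl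

theorem eval_size (i : SumExpr) : (size i).eval m L ρ = m (4 + m 1 * m 1 + i.eval m L ρ) := rfl

theorem eval_type (i u : SumExpr) : (type i u).eval m L ρ =
    m (4 + m 1 * m 1 + m 2 + (i.eval m L ρ * m 1 + u.eval m L ρ)) := rfl

theorem eval_pos (u : SumExpr) : (pos u).eval m L ρ =
    m (4 + m 1 * m 1 + m 2 + m 2 * m 1 + u.eval m L ρ) := rfl

theorem eval_loc (i : SumExpr) : (loc i).eval m L ρ =
    m (4 + m 1 * m 1 + m 2 + m 2 * m 1 + m 1 + i.eval m L ρ) := rfl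

end Eval

/-- The imbalance of the twin-cover vertex in the variable `0`. -/
def cover : SumExpr :=
  dist
    (.add (sumTo 1 k (.mul (adj (.var 0) (.var 1)) (lt (pos (.var 0)) (pos (.var 1)))))
      (sumTo 1 r (.mul (type (.var 1) (.var 0))
        (.mul (size (.var 1)) (lt (pos (.var 0)) (loc (.var 1)))))))
    (.add (sumTo 1 k (.mul (adj (.var 0) (.var 1)) (lt (pos (.var 1)) (pos (.var 0)))))
      (sumTo 1 r (.mul (type (.var 1) (.var 0))
        (.mul (size (.var 1)) (le (loc (.var 1)) (pos (.var 0)))))))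

/-- The absolute value of `δ` for the clique in the variable `0`. -/
def absDelta : SumExpr :=
  dist (sumTo 1 k (.mul (type (.var 0) (.var 1)) (le (loc (.var 0)) (pos (.var 1)))))
    (sumTo 1 k (.mul (type (.var 0) (.var 1)) (lt (pos (.var 1)) (loc (.var 0)))))

/-- The total imbalance of the clique in the variable `0`, in the closed form of `cliqueSum_eq`. -/
def clique : SumExpr :=
  .half (.sub (.add (.mul (size (.var 0)) (size (.var 0))) (.mul absDelta absDelta))
    (.mul (.sub absDelta (size (.var 0))) (.sub absDelta (size (.var 0)))))

/-- The value of the certificate. -/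
def value : SumExpr := .add (sumTo 0 k cover) (sumTo 0 r clique)

end Code

namespace Instance

variable {I : Instance} {c : I.Certificate} {m : ℕ → ℕ} {L : ℕ} {ρ : ℕ → ℕ}

theorem Layout.eval_cover (h : I.Layout m c) (hk : I.k ≤ L) (hr : I.r ≤ L) {s : Fin I.k}
    (hs : ρ 0 = s) : Code.cover.eval m L ρ = I.coverFormula c s := by
  classical
  have hk' : ∀ x, Code.k.eval m L (Function.update ρ 1 x) = I.k := fun _ => h.k
  have hr' : ∀ x, Code.r.eval m L (Function.update ρ 1 x) = I.r := fun _ => h.r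
  rw [Code.cover, eval_dist, coverFormula]
  simp only [SumExpr.eval, eval_sumTo hk' hk, eval_sumTo hr' hr, eval_lt, eval_le, Code.eval_adj,
    Code.eval_type, Code.eval_size, Code.eval_pos, Code.eval_loc, h.k, h.r, hs,
    Function.update_self, ne_eq, zero_ne_one,
    not_false_eq_true, Function.update_of_ne, h.adj, h.type, h.size, h.pos, h.loc]
  congr 1
  simp only [Finset.card_filter, Finset.sum_filter, Fin.lt_def, ite_and, ite_mul, one_mul,
    zero_mul]
  push_cast
  simp only [mul_ite, mul_one, mul_zero]
  ring

theorem Layout.eval_absDelta (h : I.Layout m c) (hk : I.k ≤ L) {i : Fin I.r}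
    (hi : ρ 0 = i) : Code.absDelta.eval m L ρ = (I.delta c i).natAbs := by
  classical
  have hk' : ∀ x, Code.k.eval m L (Function.update ρ 1 x) = I.k := fun _ => h.k
  rw [Code.absDelta, eval_dist, delta]
  simp only [SumExpr.eval, eval_sumTo hk' hk, eval_lt, eval_le,
    Code.eval_type, Code.eval_pos, Code.eval_loc, h.k, h.r, hi,
    Function.update_self, ne_eq, zero_ne_one,
    not_false_eq_true, Function.update_of_ne, h.type, h.pos, h.loc]
  congr 1
  simp only [Finset.card_filter, ite_mul, one_mul, zero_mul, Finset.sum_ite_mem, Finset.univ_inter]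

theorem Layout.eval_clique (h : I.Layout m c) (hk : I.k ≤ L) {i : Fin I.r} (hi : ρ 0 = i) :
    Code.clique.eval m L ρ = I.cliqueFormula c i := by
  have hsize : (Code.size (.var 0)).eval m L ρ = I.size i := by
    simp only [Code.eval_size, SumExpr.eval, h.k, hi, h.size]
  have h1 := I.cliqueFormula_eq c i
  rw [cliqueSum_eq] at h1
  rw [Nat.cast_injective h1]
  simp only [Code.clique, SumExpr.eval, hsize, h.eval_absDelta hk hi]

theorem Layout.eval_value (h : I.Layout m c) (hk : I.k ≤ L) (hr : I.r ≤ L) :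
    Code.value.eval m L ρ = I.formula c := by
  simp only [Code.value, SumExpr.eval]
  rw [eval_sumTo (n := Code.k) (fun _ => h.k) hk, eval_sumTo (n := Code.r) (fun _ => h.r) hr,
    formula]
  congr 1
  · exact Finset.sum_congr rfl fun s _ => h.eval_cover hk hr (Function.update_self _ _ _)
  · exact Finset.sum_congr rfl fun i _ => h.eval_clique hk (Function.update_self _ _ _)

/-- The value of a certificate is computable in strongly polynomial time. -/
theorem stronglyPolyTime_formula : RAM.StronglyPolyTime
    (fun z : (Σ I : Instance, I.Certificate) => RAM.pairCode z.1.code z.2.code)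
    (fun z => z.1.formula z.2) := by
  refine Code.value.stronglyPolyTime fun ⟨I, c⟩ => ?_
  have hL : (RAM.pairCode I.code c.code).length = 1 + I.code.length + c.code.length := by
    simp [RAM.pairCode]
    omega
  have := c.length_code
  exact (I.layout_pairCode c).eval_value (by simp only [hL]; omega) (by simp only [hL]; omega)

end Instance

/-! ### Verification of encodings -/

namespace Code

/-- The deviation of the lengths of the two sequences from those that `k` and `r` require. -/
def lengthDefect : SumExpr :=
  .add (dist (.read (.const 0)) (.add (.add (.add (.const 3) (.mul k k)) r) (.mul r k)))
    (dist .len (.add (.add (.add (.const 1) (.read (.const 0))) k) r))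

/-- A number that vanishes if and only if the entries of an encoded instance are admissible: the
adjacency matrix is symmetric with entries `0` and `1` and zero diagonal, the cliques are nonempty,
and the characteristic vectors have entries `0` and `1`. -/
def instanceDefect : SumExpr :=
  .add (.add (.add
    (sumTo 0 k (sumTo 1 k (.add (.sub (adj (.var 0) (.var 1)) (.const 1))
      (dist (adj (.var 0) (.var 1)) (adj (.var 1) (.var 0))))))
    (sumTo 0 k (adj (.var 0) (.var 0))))
    (sumTo 0 r (.sub (.const 1) (size (.var 0)))))
    (sumTo 0 r (sumTo 1 k (.sub (type (.var 0) (.var 1)) (.const 1))))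

/-- A number that vanishes if and only if an encoded certificate is admissible: the positions are
distinct numbers below `k`, and the locations are at most `k`. -/
def certificateDefect : SumExpr :=
  .add (.add
    (sumTo 0 k (le k (pos (.var 0))))
    (sumTo 0 k (sumTo 1 k (.mul (lt (.var 0) (.var 1))
      (.sub (.const 1) (dist (pos (.var 0)) (pos (.var 1))))))))
    (sumTo 0 r (.sub (loc (.var 0)) k))

/-- The verifier: the value is `1` if the input consists of the encodings of an instance and of a
certificate for it whose value is at most the target, and `0` otherwise. -/
def verifier : SumExpr :=
  .sub (.const 1) (.add (.add (.add lengthDefect instanceDefect) certificateDefect)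
    (.sub value target))

end Code

namespace Instance

variable {m : ℕ → ℕ} {L : ℕ} {ρ : ℕ → ℕ}

theorem eval_lengthDefect_eq_zero : Code.lengthDefect.eval m L ρ = 0 ↔
    m 0 = 3 + m 1 * m 1 + m 2 + m 2 * m 1 ∧ L = 1 + m 0 + m 1 + m 2 := by
  simp only [Code.lengthDefect, SumExpr.eval, Nat.add_eq_zero_iff, eval_dist_eq_zero,
    Code.eval_k, Code.eval_r]

theorem eval_instanceDefect_eq_zero (hk : m 1 ≤ L) (hr : m 2 ≤ L) :
    Code.instanceDefect.eval m L ρ = 0 ↔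
      (∀ u v : Fin (m 1), m (4 + (u * m 1 + v)) ≤ 1 ∧
        m (4 + (u * m 1 + v)) = m (4 + (v * m 1 + u))) ∧
      (∀ u : Fin (m 1), m (4 + (u * m 1 + u)) = 0) ∧
      (∀ i : Fin (m 2), 0 < m (4 + m 1 * m 1 + i)) ∧
      (∀ (i : Fin (m 2)) (u : Fin (m 1)), m (4 + m 1 * m 1 + m 2 + (i * m 1 + u)) ≤ 1) := by
  have hk0 : ∀ (ρ : ℕ → ℕ) v x, Code.k.eval m L (Function.update ρ v x) = m 1 := fun _ _ _ => rfl
  have hr0 : ∀ (ρ : ℕ → ℕ) v x, Code.r.eval m L (Function.update ρ v x) = m 2 := fun _ _ _ => rfl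
  simp only [Code.instanceDefect, SumExpr.eval, Nat.add_eq_zero_iff, eval_sumTo (hk0 _ _) hk,
    eval_sumTo (hr0 _ _) hr, Finset.sum_eq_zero_iff, Finset.mem_univ, true_imp_iff,
    eval_dist_eq_zero, Code.eval_adj, Code.eval_type, Code.eval_size,
    Function.update_self, ne_eq, zero_ne_one, not_false_eq_true, Function.update_of_ne,
    Nat.sub_eq_zero_iff_le, and_assoc, Nat.one_le_iff_ne_zero, Nat.pos_iff_ne_zero]

theorem eval_certificateDefect_eq_zero (hk : m 1 ≤ L) (hr : m 2 ≤ L) :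
    Code.certificateDefect.eval m L ρ = 0 ↔
      (∀ u : Fin (m 1), m (4 + m 1 * m 1 + m 2 + m 2 * m 1 + u) < m 1) ∧
      (∀ u v : Fin (m 1), u < v → m (4 + m 1 * m 1 + m 2 + m 2 * m 1 + u) ≠
        m (4 + m 1 * m 1 + m 2 + m 2 * m 1 + v)) ∧
      (∀ i : Fin (m 2), m (4 + m 1 * m 1 + m 2 + m 2 * m 1 + m 1 + i) ≤ m 1) := by
  have hk0 : ∀ (ρ : ℕ → ℕ) v x, Code.k.eval m L (Function.update ρ v x) = m 1 := fun _ _ _ => rfl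
  have hr0 : ∀ (ρ : ℕ → ℕ) v x, Code.r.eval m L (Function.update ρ v x) = m 2 := fun _ _ _ => rfl
  simp only [Code.certificateDefect, SumExpr.eval, Nat.add_eq_zero_iff,
    eval_sumTo (hk0 _ _) hk, eval_sumTo (hr0 _ _) hr, Finset.sum_eq_zero_iff, Finset.mem_univ,
    true_imp_iff, eval_lt, eval_le, Code.eval_pos, Code.eval_loc, Code.eval_k,
    Function.update_self, ne_eq, zero_ne_one,
    not_false_eq_true, Function.update_of_ne, Nat.sub_eq_zero_iff_le, and_assoc, mul_eq_zero,
    ite_eq_right_iff, one_ne_zero, imp_false, not_le, not_lt, Nat.one_le_iff_ne_zero,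
    eval_dist_eq_zero, Fin.lt_def, or_iff_not_imp_left]

/-- A memory without defects holds an instance and a certificate. -/
theorem exists_layout (hlen : m 0 = 3 + m 1 * m 1 + m 2 + m 2 * m 1) (hk : m 1 ≤ L)
    (hr : m 2 ≤ L) (h1 : Code.instanceDefect.eval m L ρ = 0)
    (h2 : Code.certificateDefect.eval m L ρ = 0) :
    ∃ (I : Instance) (c : I.Certificate), I.Layout m c := by
  classical
  rw [eval_instanceDefect_eq_zero hk hr] at h1
  rw [eval_certificateDefect_eq_zero hk hr] at h2
  obtain ⟨hadj, hdiag, hsize, htype⟩ := h1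
  obtain ⟨hpos, hinj, hloc⟩ := h2
  have hbij : Function.Bijective fun u : Fin (m 1) => (⟨_, hpos u⟩ : Fin (m 1)) := by
    rw [← Finite.injective_iff_bijective]
    intro u v huv
    rw [Fin.mk.injEq] at huv
    rcases lt_trichotomy u v with h | h | h
    · exact absurd huv (hinj u v h)
    · exact h
    · exact absurd huv.symm (hinj v u h)
  let I : Instance :=
    { k := m 1
      H :=
        { Adj := fun u v => m (4 + (u * m 1 + v)) = 1
          symm := ⟨fun u v h => by rw [← (hadj u v).2]; exact h⟩
          loopless := ⟨fun u h => by rw [hdiag u] at h; exact absurd h zero_ne_one⟩ }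
      r := m 2
      size := fun i => m (4 + m 1 * m 1 + i)
      size_pos := hsize
      type := fun i => Finset.univ.filter fun u =>
        m (4 + m 1 * m 1 + m 2 + (i * m 1 + u)) = 1
      target := m 3 }
  have hbool : ∀ n, n ≤ 1 → n = if n = 1 then 1 else 0 := fun n hn => by
    split_ifs <;> omega
  refine ⟨I, ⟨Equiv.ofBijective _ hbij, fun i => ⟨_, Nat.lt_succ_of_le (hloc i)⟩⟩, hlen, rfl, rfl,
    rfl, fun u v => ?_, fun i => rfl, fun i u => ?_, fun u => rfl, fun i => rfl⟩
  · convert hbool _ (hadj u v).1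
  · simpa [I] using hbool _ (htype i u)

theorem eval_verifier_eq_one (x y : List ℕ) :
    Code.verifier.eval (RAM.load (RAM.pairCode x y)).mem (RAM.pairCode x y).length
        (fun _ => 0) = 1 ↔
      ∃ (I : Instance) (c : I.Certificate), I.code = x ∧ c.code = y ∧
        I.formula c ≤ I.target := by
  have hL : (RAM.pairCode x y).length = 1 + x.length + y.length := by
    simp [RAM.pairCode]
    omega
  have hx : (RAM.load (RAM.pairCode x y)).mem 0 = x.length := rfl
  have hone : ∀ n : ℕ, 1 - n = 1 ↔ n = 0 := fun n => by omega
  simp only [Code.verifier, SumExpr.eval, hone, Nat.add_eq_zero_iff, Code.target,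
    eval_lengthDefect_eq_zero, Nat.sub_eq_zero_iff_le]
  constructor
  · rintro ⟨⟨⟨⟨hlen, hlen'⟩, h1⟩, h2⟩, hval⟩
    rw [hL] at hlen'
    obtain ⟨I, c, h⟩ := exists_layout hlen (by omega) (by omega) h1 h2
    rw [h.eval_value (by rw [← h.k]; omega) (by rw [← h.r]; omega), h.target] at hval
    have hcode := h.eq_code (by rw [← h.k, ← h.r]; omega)
    exact ⟨I, c, hcode.1, hcode.2, hval⟩
  · rintro ⟨I, c, rfl, rfl, hval⟩
    have h := I.layout_pairCode c
    have hc := c.length_code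
    have hkL : I.k ≤ (RAM.pairCode I.code c.code).length := by omega
    have hrL : I.r ≤ (RAM.pairCode I.code c.code).length := by omega
    rw [h.eval_value hkL hrL, h.target, eval_instanceDefect_eq_zero (by rwa [h.k]) (by rwa [h.r]),
      eval_certificateDefect_eq_zero (by rwa [h.k]) (by rwa [h.r]), h.length, h.k, h.r]
    refine ⟨⟨⟨⟨rfl, by rw [hL, I.length_code]; omega⟩, fun u v => ?_, fun u => ?_, fun i => ?_,
      fun i u => ?_⟩, fun u => ?_, fun u v huv => ?_, fun i => ?_⟩, hval⟩
    · rw [h.adj, h.adj, I.H.adj_comm]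
      exact ⟨by split_ifs <;> omega, rfl⟩
    · rw [h.adj, if_neg (I.H.loopless.irrefl u)]
    · rw [h.size]
      exact I.size_pos i
    · rw [h.type]
      split_ifs <;> omega
    · rw [h.pos]
      exact (c.pos u).isLt
    · rw [h.pos, h.pos]
      exact fun he => huv.ne (c.pos.injective (Fin.ext he))
    · rw [h.loc]
      exact Nat.le_of_lt_succ (c.loc i).isLt

end Instance

theorem succinctImbalance_inNP : RAM.InNP succinctImbalance := by
  refine ⟨fun z => Code.verifier.eval (RAM.load (RAM.pairCode z.1 z.2)).mem
    (RAM.pairCode z.1 z.2).length fun _ => 0, Polynomial.X ^ 2,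
    (Code.verifier.stronglyPolyTime fun _ => rfl).polyTime, fun x => ?_⟩
  simp only [Instance.eval_verifier_eq_one]
  constructor
  · rintro ⟨I, rfl, hI⟩
    obtain ⟨c, hc⟩ := I.isYes_iff.1 hI
    exact ⟨c.code, c.bitLength_code_le, I, c, rfl, rfl, hc⟩
  · rintro ⟨_, -, I, c, rfl, -, hc⟩
    exact ⟨I, rfl, I.isYes_iff.2 ⟨c, hc⟩⟩

end Imbalance

theorem mainTheorem4 :
    -- membership in NP
    RAM.InNP Imbalance.succinctImbalance ∧
    -- the certificate for YES-instances, and its length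
    (∀ I : Imbalance.Instance, I.IsYes ↔ ∃ c : I.Certificate, I.formula c ≤ I.target) ∧
    (∃ P : Polynomial ℕ, ∀ (I : Imbalance.Instance) (c : I.Certificate),
      RAM.bitLength c.code ≤ P.eval (RAM.bitLength I.code)) ∧
    -- certificates describe exactly the clean orderings, and determine their imbalance
    (∀ (I : Imbalance.Instance) (σ : Imbalance.Ordering I.Vertex), I.IsClean σ →
      ∃ c : I.Certificate, I.Realizes σ c) ∧
    (∀ (I : Imbalance.Instance) (c : I.Certificate),
      (∃ σ : Imbalance.Ordering I.Vertex, I.IsClean σ ∧ I.Realizes σ c) ∧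
      ∀ σ : Imbalance.Ordering I.Vertex, I.IsClean σ → I.Realizes σ c →
        Imbalance.orderingImbalance I.graph σ = I.formula c) ∧
    -- the closed formulas are computable in strongly polynomial time
    RAM.StronglyPolyTime
      (fun z : (Σ I : Imbalance.Instance, I.Certificate) => RAM.pairCode z.1.code z.2.code)
      (fun z => z.1.formula z.2) :=
  ⟨Imbalance.succinctImbalance_inNP, fun I => I.isYes_iff,
    ⟨_, fun _ c => c.bitLength_code_le⟩, fun _ _ h => h.exists_realizes,
    fun I c => ⟨I.exists_clean_realizes c, fun _ _ h => I.orderingImbalance_eq_formula h⟩,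
    Imbalance.Instance.stronglyPolyTime_formula⟩
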